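/- **Setting.** Let $n,b\ge 1$, let $\ell_{ij}:\mathbb R^d\to\mathbb R$ ($1\le i\le n$, $1\le j\le q$) be losses such that every instance loss $\ell_i=\sum_{j=1}^q\ell_{ij}$ is differentiable, and let $\ell=\frac1n\sum_{i=1}^n\ell_i$ be the empirical objective. Assume that $\ell$ is bounded below and that $\nabla\ell$ is $L$-Lipschitz. Fix $\Delta>0$ and constants $W,\bar s,G$. *Sampling.* For a weight vector $w\in\mathbb R^n$ and a selection pressure $s\ge 1$ put $$Q(w_i)=\Big\lceil 1-\frac{w_i}{\Delta}\Big\rceil,\qquad P(i\mid w,s)=\frac{1/\exp(\log (s)/n)^{Q(w_i)}}{\sum_{j=1}^n 1/\exp(\log (s)/n)^{Q(w_j)}} .$$ At iteration $t=1,2,\dots$ the D2ACE sampling distribution is the Bernoulli mixture $$P_t(i)=p_t\,P(i\mid w_{U,t},s_t)+(1-p_t)\,P(i\mid w_{H,t},s_t),$$ with numbers $p_t\in[0,1]$ and $s_t\in[1,\bar s]$, and uncertainty and hardness weights $w_{U,t},w_{H,t}\in[-W,W]^n$ that are arbitrary random vectors measurable with respect to the past $\mathcal F_t$ before iteration $t$.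 Given $\mathcal F_t$, the members $i_1,\dots,i_b$ of the mini-batch are drawn i.i.d. from $P_t$, and the stochastic gradient at the current parameter $x_t$ is $$g_t=\frac1b\sum_{k=1}^b\frac{1}{n\,P_t(i_k)}\nabla\ell_{i_k}(x_t).$$ *Generic Adam.* With fixed $x_1\in\mathbb R^d$, $m_0=0$, $v_0=(\varepsilon,\dots,\varepsilon)$, $\varepsilon>0$, for $t\ge1$ and coordinatewise, $$v_t=\theta_tv_{t-1}+(1-\theta_t)g_t^2,\qquad m_t=\beta_tm_{t-1}+(1-\beta_t)g_t,\qquad x_{t+1}=x_t-\alpha_t\frac{m_t}{\sqrt{v_t}} .$$ Only runs are considered along which, almost surely, $\|\nabla\ell_i(x_t)\|^2\le G$ for all $i$ and all $t\ge1$. For $T\ge1$ let $\tau$ be uniform on $\{1,\dots,T\}$ and independent of the run, so that $\mathbb E\|\nabla\ell(x_\tau)\|^2=\frac1T\sum_{t=1}^T\mathbb E\|\nabla\ell(x_t)\|^2$. **Theorem.** 1. *Assumptions (A1)–(A4).* All probabilities $P_t(i)$ are positive, and there is a constant $\widetilde G>0$, independent of $t$, of the run and of $\alpha_t,\beta_t,\theta_t$,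 such that in every run: (A1) $\ell$ is bounded below; (A2) $\nabla\ell$ is $L$-Lipschitz; (A3) $\mathbb E[g_t\mid\mathcal F_t]=\nabla\ell(x_t)$ almost surely for all $t\ge 1$; (A4) $\mathbb E\|g_t\|^2\le\widetilde G$ for all $t\ge 1$. Moreover $\mathbb E\|\nabla\ell(x_t)\|^2<\infty$ for all $t\ge1$. 2. *Convergence.* Let $\alpha_t>0$ for $t\ge1$, and suppose that (i) $0\le\beta_t\le\beta<1$ for all $t$, for some $\beta$; (ii) $0<\theta_t<1$ and $\theta_t$ is non-decreasing in $t$; (iii) $\chi_t=\alpha_t/\sqrt{1-\theta_t}$ is almost non-increasing, i.e. there are a non-increasing sequence $(a_t)$ and a constant $C_0>0$ with $a_t\le\chi_t\le C_0a_t$ for all $t$; (iv) $\dfrac{\sum_{t=1}^T\alpha_t\sqrt{1-\theta_t}}{T\alpha_T}\to0$ as $T\to\infty$. Then $\mathbb E\|\nabla\ell(x_\tau)\|^2\to0$ as $T\to\infty$, uniformly over all runs: there is a sequence $u_T\to0$, the same for all runs, with $\mathbb E\|\nabla\ell(x_\tau)\|^2\le u_T$ for all $T\ge1$. 3. *Rates.*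 Let $\eta>0$, $0<r\le2s<2$, $K\in\mathbb N$ with $K\ge 1$, $0<\alpha<K^r$, $0\le\beta_t\le\beta<1$, $\alpha_t=\eta/t^s$, and $\theta_t=1-\alpha/K^r$ for $t<K$, $\theta_t=1-\alpha/t^r$ for $t\ge K$. Then there is a constant $C>0$, the same for all runs, such that for all $T\ge2$ $$\mathbb E\|\nabla\ell(x_\tau)\|^2\le C\cdot\begin{cases}T^{-r/2},&\frac r2+s<1,\\[2pt] \dfrac{\log T}{T^{1-s}},&\frac r2+s=1,\\[4pt] T^{-(1-s)},&\frac r2+s>1.\end{cases}$$ -/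

import Mathlib

open MeasureTheory ProbabilityTheory Filter Topology Finset

noncomputable section

namespace D2ACE

/-- The space of model parameters, with the Euclidean norm. -/
abbrev Param (d : ℕ) : Type := EuclideanSpace ℝ (Fin d)

/-! ### Multi-label training losses -/

/-- The loss of instance `i`: the sum of its per-label losses. -/
def instanceLoss {d n q : ℕ} (loss : Fin n → Fin q → Param d → ℝ) (i : Fin n) (x : Param d) : ℝ :=
  ∑ j, loss i j x

/-- The empirical objective: the mean of the instance losses. -/
def empiricalLoss {d n q : ℕ} (loss : Fin n → Fin q → Param d → ℝ) (x : Param d) : ℝ :=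
  (1 / (n : ℝ)) * ∑ i, instanceLoss loss i x

/-! ### The sampling distribution -/

/-- The quantization index of a weight `w` with quantization step `Δ`. -/
def quantIndex (Δ w : ℝ) : ℤ := ⌈1 - w / Δ⌉

/-- The sampling probability of instance `i` that a weight vector `w` induces, for the
selection pressure `s` and the quantization step `Δ`. -/
def weightProb {n : ℕ} (Δ s : ℝ) (w : Fin n → ℝ) (i : Fin n) : ℝ :=
  (1 / Real.exp (Real.log s / n) ^ quantIndex Δ (w i)) /
    ∑ j, 1 / Real.exp (Real.log s / n) ^ quantIndex Δ (w j)

/-- The Bernoulli mixture of the uncertainty-aware and the hardness-aware sampling probability. -/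
def mixtureProb {n : ℕ} (Δ s p : ℝ) (wU wH : Fin n → ℝ) (i : Fin n) : ℝ :=
  p * weightProb Δ s wU i + (1 - p) * weightProb Δ s wH i

/-- The importance-weighted mini-batch gradient estimator at the parameter `x`, for the batch
`B` (a `b`-tuple of instances) and the sampling probabilities `P`. -/
def gradEstimator {d n q b : ℕ} (loss : Fin n → Fin q → Param d → ℝ) (P : Fin n → ℝ)
    (B : Fin b → Fin n) (x : Param d) : Param d :=
  (1 / (b : ℝ)) • ∑ k, (1 / ((n : ℝ) * P (B k))) • gradient (instanceLoss loss (B k)) x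

/-! ### Generic Adam driven by the estimator -/

/-- A run of generic Adam, on the probability space `(Ω, μ)`, whose stochastic gradients are the
importance-weighted mini-batch gradients. Iterations are numbered `t = 1, 2, 3, …`, and `ℱ t`
is the information available just before the batch of iteration `t` is drawn.

* `α`, `β`, `θ`: stepsizes, first-moment decays and second-moment decays of generic Adam;
* `ε`: the common initial value of all coordinates of the second-moment estimate;
* `x₁`: the initial parameter;
* `Δ`: the quantization step; `W`: a bound for the weights; `sMax`: the largest selection pressure.

The weight vectors may depend in any way on the past of the run (and on further randomness). -/
structure Run {d n q : ℕ} (loss : Fin n → Fin q → Param d → ℝ) (b : ℕ) (Δ W sMax : ℝ)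
    (α β θ : ℕ → ℝ) (ε : ℝ) (x₁ : Param d)
    {Ω : Type*} [mΩ : MeasurableSpace Ω] (μ : Measure Ω) where
  /-- the past before each draw -/
  ℱ : Filtration ℕ mΩ
  /-- the mixing coefficients -/
  p : ℕ → ℝ
  /-- the selection pressures -/
  s : ℕ → ℝ
  /-- the uncertainty-based weights of the instances -/
  wU : ℕ → Ω → Fin n → ℝ
  /-- the hardness-based weights of the instances -/
  wH : ℕ → Ω → Fin n → ℝ
  /-- the mini-batches -/
  B : ℕ → Ω → Fin b → Fin n
  /-- the parameters -/
  x : ℕ → Ω → Param d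
  /-- the first-moment estimates -/
  m : ℕ → Ω → Param d
  /-- the second-moment estimates -/
  v : ℕ → Ω → Param d
  p_mem : ∀ t, 1 ≤ t → p t ∈ Set.Icc (0 : ℝ) 1
  s_mem : ∀ t, 1 ≤ t → s t ∈ Set.Icc 1 sMax
  wU_measurable : ∀ t, 1 ≤ t → Measurable[ℱ t] (wU t)
  wH_measurable : ∀ t, 1 ≤ t → Measurable[ℱ t] (wH t)
  wU_bounded : ∀ t, 1 ≤ t → ∀ ω i, |wU t ω i| ≤ W
  wH_bounded : ∀ t, 1 ≤ t → ∀ ω i, |wH t ω i| ≤ W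
  B_measurable : ∀ t, 1 ≤ t → Measurable[ℱ (t + 1)] (B t)
  /-- given the past, the members of the batch are i.i.d. with the mixture probabilities -/
  B_law : ∀ t, 1 ≤ t → ∀ c : Fin b → Fin n,
    μ[(B t ⁻¹' {c}).indicator (fun _ => (1 : ℝ)) | ℱ t] =ᵐ[μ]
      fun ω => ∏ k, mixtureProb Δ (s t) (p t) (wU t ω) (wH t ω) (c k)
  x_init : ∀ ω, x 1 ω = x₁
  m_init : ∀ ω k, m 0 ω k = 0
  v_init : ∀ ω k, v 0 ω k = ε
  v_step : ∀ t, 1 ≤ t → ∀ ω k, v t ω k = θ t * v (t - 1) ω k + (1 - θ t) *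
    (gradEstimator loss (mixtureProb Δ (s t) (p t) (wU t ω) (wH t ω)) (B t ω) (x t ω) k) ^ 2
  m_step : ∀ t, 1 ≤ t → ∀ ω k, m t ω k = β t * m (t - 1) ω k + (1 - β t) *
    gradEstimator loss (mixtureProb Δ (s t) (p t) (wU t ω) (wH t ω)) (B t ω) (x t ω) k
  x_step : ∀ t, 1 ≤ t → ∀ ω k,
    x (t + 1) ω k = x t ω k - α t * m t ω k / Real.sqrt (v t ω k)

namespace Run

variable {d n q : ℕ} {loss : Fin n → Fin q → Param d → ℝ} {b : ℕ} {Δ W sMax : ℝ}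
  {α β θ : ℕ → ℝ} {ε : ℝ} {x₁ : Param d} {Ω : Type*} [mΩ : MeasurableSpace Ω] {μ : Measure Ω}

/-- The sampling probabilities of iteration `t`. -/
def prob (R : Run loss b Δ W sMax α β θ ε x₁ μ) (t : ℕ) (ω : Ω) : Fin n → ℝ :=
  mixtureProb Δ (R.s t) (R.p t) (R.wU t ω) (R.wH t ω)

/-- The stochastic gradient of iteration `t`. -/
def g (R : Run loss b Δ W sMax α β θ ε x₁ μ) (t : ℕ) (ω : Ω) : Param d :=
  gradEstimator loss (R.prob t ω) (R.B t ω) (R.x t ω)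

/-- Along the run, all squared norms of instance gradients are at most `G`. -/
def GradBounded (R : Run loss b Δ W sMax α β θ ε x₁ μ) (G : ℝ) : Prop :=
  ∀ᵐ ω ∂μ, ∀ t, 1 ≤ t → ∀ i, ‖gradient (instanceLoss loss i) (R.x t ω)‖ ^ 2 ≤ G

/-- The expected squared norm of the full gradient at an iterate that is chosen uniformly among
the first `T` iterates, independently of the run. -/
def meanSqGrad (R : Run loss b Δ W sMax α β θ ε x₁ μ) (T : ℕ) : ℝ :=
  (1 / (T : ℝ)) * ∑ t ∈ Icc 1 T, ∫ ω, ‖gradient (empiricalLoss loss) (R.x t ω)‖ ^ 2 ∂μ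

end Run

/-- Assumptions (A1)–(A4) on an objective `f`, with Lipschitz constant `L` and second-moment
bound `G`, for iterates `x t` and stochastic gradients `g t`, `t ≥ 1`, where `ℱ t` is the past
before `g t` is drawn. -/
structure AdamAssumptions {d : ℕ} {Ω : Type*} [mΩ : MeasurableSpace Ω] (μ : Measure Ω)
    (ℱ : Filtration ℕ mΩ) (f : Param d → ℝ) (L : NNReal) (G : ℝ) (x g : ℕ → Ω → Param d) :
    Prop where
  lower_bounded : BddBelow (Set.range f)
  differentiable : Differentiable ℝ f
  lipschitz_gradient : LipschitzWith L (gradient f)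
  integrable : ∀ t, 1 ≤ t → Integrable (g t) μ
  unbiased : ∀ t, 1 ≤ t → μ[g t | ℱ t] =ᵐ[μ] fun ω => gradient f (x t ω)
  integrable_sq : ∀ t, 1 ≤ t → Integrable (fun ω => ‖g t ω‖ ^ 2) μ
  second_moment : ∀ t, 1 ≤ t → ∫ ω, ‖g t ω‖ ^ 2 ∂μ ≤ G

/-! ### Parameters of generic Adam -/

/-- A sequence `χ 1, χ 2, …` is almost non-increasing if it is comparable, up to a constant, to
a non-increasing one. -/
def AlmostNonincreasing (χ : ℕ → ℝ) : Prop :=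
  ∃ a : ℕ → ℝ, ∃ C₀ : ℝ, 0 < C₀ ∧ AntitoneOn a (Set.Ici 1) ∧
    ∀ t, 1 ≤ t → a t ≤ χ t ∧ χ t ≤ C₀ * a t

/-- The momentum parameters are nonnegative and bounded away from `1`. -/
def MomentumBounded (β : ℕ → ℝ) : Prop :=
  ∃ β₀ : ℝ, β₀ < 1 ∧ ∀ t, 1 ≤ t → 0 ≤ β t ∧ β t ≤ β₀

/-- The sufficient condition on the parameters for the convergence of generic Adam. -/
structure SufficientCondition (α β θ : ℕ → ℝ) : Prop where
  stepsize_pos : ∀ t, 1 ≤ t → 0 < α t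
  momentum : MomentumBounded β
  theta_mem : ∀ t, 1 ≤ t → 0 < θ t ∧ θ t < 1
  theta_mono : MonotoneOn θ (Set.Ici 1)
  effective_stepsize : AlmostNonincreasing fun t => α t / Real.sqrt (1 - θ t)
  stepsize_ratio : Tendsto
    (fun T : ℕ => (∑ t ∈ Icc 1 T, α t * Real.sqrt (1 - θ t)) / (T * α T)) atTop (𝓝 0)

/-- The stepsizes `η / t ^ s`. -/
def polyStep (η s : ℝ) (t : ℕ) : ℝ := η / (t : ℝ) ^ s

/-- The second-moment decays `1 - a / t ^ r`, kept constant before the index `K`. -/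
def polyTheta (a r : ℝ) (K t : ℕ) : ℝ :=
  if t < K then 1 - a / (K : ℝ) ^ r else 1 - a / (t : ℝ) ^ r

/-- The convergence rate for the stepsizes `η / t ^ s` and second-moment decays `1 - a / t ^ r`. -/
def adamRate (r s : ℝ) (T : ℕ) : ℝ :=
  if r / 2 + s < 1 then (T : ℝ) ^ (-(r / 2))
  else if r / 2 + s = 1 then Real.log T / (T : ℝ) ^ (1 - s)
  else (T : ℝ) ^ (-(1 - s))

end D2ACE

end

/-! Bounded weights and selection pressures keep every quantization index and every base of the
powers in a fixed range, so all sampling probabilities are at least one positive constant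
(`exists_weightProb_lower_bound`). The importance weights are therefore bounded, and almost surely
both g_t and the full gradient have norm at most a deterministic M (`exists_uniform_bounds`).
Unbiasedness holds because the weight 1/(n P(i)) cancels the sampling law (`Run.condExp_g`).

For the convergence, write D_t = ∇ℓ(x_t), U_t = m_t/√v_t and w_t = √(1-θ_t). The quadratic upper
bound for ℓ controls Σ α_t ⟨D_t, U_t⟩ from above (`AdamPath.sum_inner_le`). From below, X_t = E⟨D_t,
U_t⟩ obeys X_{t+1} ≥ β_{t+1} X_t + κ E‖D_{t+1}‖² - error; the pathwise form is
`AdamPath.inner_step`. The obstacle is that v_{t+1} depends on g_{t+1}. It is replaced by θ v_t +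
(1-θ) M², which is known before the draw, so that conditioning turns g_{t+1} into D_{t+1}
(`ScalarAdam.gradient_term_ge`, `integral_inner_eq_of_condExp`).

The errors reduce to the normalized energies (1-θ)g²/v and (1-θ)m²/v. The first is at most an
increment of log v plus O(1-θ), so it telescopes because v is bounded (`ScalarAdam.sum_e_le`). The
second satisfies a discounted recursion driven by the first, with factor β₀/θ_t tending to β₀ < 1
(`ScalarAdam.exists_h_le`, `ScalarAdam.sum_h_le`). With weights a_t w_t, where a_t is the
non-increasing sequence comparable to α_t/w_t, all error sums are O(1 + Σ α_t w_t).

Unrolling the recursion (`weighted_average_bound`) and dividing by T α_T gives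
`exists_meanSqGrad_bound`. Its constant is fixed before the run, whence the uniformity. Condition
(iv) forces θ_t → 1 and makes the bound vanish; for polynomial parameters it remains to estimate Σ
t^{-(s+r/2)}. -/

namespace D2ACE

/-! ### Uniform lower bounds for the sampling probabilities -/

section Sampling

variable {n : ℕ} {Δ s : ℝ} {w : Fin n → ℝ}

theorem weightProb_term_pos (i : Fin n) :
    0 < 1 / Real.exp (Real.log s / n) ^ quantIndex Δ (w i) := by positivity

theorem weightProb_sum_pos (hn : 0 < n) :
    0 < ∑ j : Fin n, 1 / Real.exp (Real.log s / n) ^ quantIndex Δ (w j) :=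
  Finset.sum_pos (fun j _ => weightProb_term_pos j) ⟨⟨0, hn⟩, Finset.mem_univ _⟩

theorem sum_weightProb (hn : 0 < n) : ∑ i, weightProb Δ s w i = 1 := by
  unfold weightProb
  rw [← Finset.sum_div, div_self (weightProb_sum_pos hn).ne']

theorem sum_mixtureProb (hn : 0 < n) {p : ℝ} {w' : Fin n → ℝ} :
    ∑ i, mixtureProb Δ s p w w' i = 1 := by
  simp only [mixtureProb, Finset.sum_add_distrib, ← Finset.mul_sum, sum_weightProb hn]
  ring

theorem abs_quantIndex_le {W x : ℝ} (hΔ : 0 < Δ) (hx : |x| ≤ W) :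
    |quantIndex Δ x| ≤ (⌈1 + W / Δ⌉₊ : ℤ) := by
  have h1 : |x / Δ| ≤ W / Δ := by
    rw [abs_div, abs_of_pos hΔ]; gcongr
  have h2 := abs_le.1 h1
  have h3 : 1 + W / Δ ≤ (⌈1 + W / Δ⌉₊ : ℝ) := Nat.le_ceil _
  have h4 := Int.le_ceil (1 - x / Δ)
  unfold quantIndex
  rw [abs_le]
  constructor
  · have : (-(⌈1 + W / Δ⌉₊ : ℝ)) ≤ (⌈1 - x / Δ⌉ : ℝ) := by linarith
    exact_mod_cast this
  · refine Int.ceil_le.2 ?_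
    push_cast
    linarith

/-- Sampling probabilities are bounded below, uniformly over bounded weights. -/
theorem exists_weightProb_lower_bound (hn : 0 < n) (hΔ : 0 < Δ) (W sMax : ℝ) :
    ∃ c : ℝ, 0 < c ∧ ∀ s ∈ Set.Icc 1 sMax, ∀ w : Fin n → ℝ, (∀ i, |w i| ≤ W) →
      ∀ i, c ≤ weightProb Δ s w i := by
  have hn' : (0 : ℝ) < n := by exact_mod_cast hn
  set N : ℕ := ⌈1 + W / Δ⌉₊
  set R : ℝ := Real.exp (Real.log sMax / n)
  have hR : 0 < R := Real.exp_pos _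
  -- Each unnormalized weight lies in [R^(-N), R^N], and the denominator has n terms.
  refine ⟨1 / R ^ N / (n * R ^ N), by positivity, fun s hs w hw i => ?_⟩
  set ρ : ℝ := Real.exp (Real.log s / n)
  have hρ1 : 1 ≤ ρ := by
    refine Real.one_le_exp (div_nonneg (Real.log_nonneg hs.1) hn'.le)
  have hρR : ρ ≤ R := by
    refine Real.exp_le_exp.2 ?_
    have : Real.log s ≤ Real.log sMax := Real.log_le_log (by linarith [hs.1]) hs.2
    gcongr
  have hρ0 : 0 < ρ := by linarith
  have hq : ∀ j, |quantIndex Δ (w j)| ≤ (N : ℤ) := fun j => abs_quantIndex_le hΔ (hw j)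
  have lo : ∀ j, 1 / R ^ N ≤ 1 / ρ ^ quantIndex Δ (w j) := by
    intro j
    have h1 : ρ ^ quantIndex Δ (w j) ≤ ρ ^ (N : ℤ) := zpow_le_zpow_right₀ hρ1 (abs_le.1 (hq j)).2
    have h2 : ρ ^ (N : ℤ) ≤ R ^ N := by rw [zpow_natCast]; gcongr
    exact one_div_le_one_div_of_le (by positivity) (h1.trans h2)
  have hi : ∀ j, 1 / ρ ^ quantIndex Δ (w j) ≤ R ^ N := by
    intro j
    have h1 : ρ ^ (-quantIndex Δ (w j)) ≤ ρ ^ (N : ℤ) :=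
      zpow_le_zpow_right₀ hρ1 (by linarith [(abs_le.1 (hq j)).1])
    have h2 : ρ ^ (N : ℤ) ≤ R ^ N := by rw [zpow_natCast]; gcongr
    rw [one_div, ← zpow_neg]
    exact h1.trans h2
  unfold weightProb
  refine div_le_div₀ (weightProb_term_pos i).le (lo i) (weightProb_sum_pos hn) ?_
  calc ∑ j, 1 / ρ ^ quantIndex Δ (w j) ≤ ∑ _j : Fin n, R ^ N := Finset.sum_le_sum fun j _ => hi j
    _ = n * R ^ N := by simp

theorem le_mixtureProb {c p : ℝ} {w' : Fin n → ℝ} (hp : p ∈ Set.Icc (0 : ℝ) 1)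
    {i : Fin n} (h : c ≤ weightProb Δ s w i) (h' : c ≤ weightProb Δ s w' i) :
    c ≤ mixtureProb Δ s p w w' i := by
  unfold mixtureProb
  nlinarith [hp.1, hp.2, mul_le_mul_of_nonneg_left h hp.1,
    mul_le_mul_of_nonneg_left h' (sub_nonneg.2 hp.2)]

theorem measurable_weightProb (Δ s : ℝ) (i : Fin n) :
    Measurable fun w : Fin n → ℝ => weightProb Δ s w i := by
  have h : ∀ j : Fin n, Measurable fun w : Fin n → ℝ =>
      1 / Real.exp (Real.log s / n) ^ quantIndex Δ (w j) := by
    intro j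
    have h0 : Measurable fun w : Fin n → ℝ => 1 - w j / Δ := by fun_prop
    have h1 : Measurable fun w : Fin n → ℝ => quantIndex Δ (w j) := Int.measurable_ceil.comp h0
    exact (measurable_from_top (f := fun k : ℤ => 1 / Real.exp (Real.log s / n) ^ k)).comp h1
  exact (h i).div (Finset.measurable_sum _ fun j _ => h j)

end Sampling

/-! ### The importance-weighted estimator for a fixed distribution -/

section Estimator

/-- The marginals of a product law are its factors: once `F` is inserted into the factor `j`, the
sum of products factorizes, and every other factor sums to 1. -/
theorem sum_prod_mul_apply {ι κ : Type*} [Fintype ι] [DecidableEq ι] [Fintype κ]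
    {P : κ → ℝ} (hP : ∑ i, P i = 1) (F : κ → ℝ) (j : ι) :
    ∑ c : ι → κ, (∏ k, P (c k)) * F (c j) = ∑ i, P i * F i := by
  have h1 : ∀ c : ι → κ, (∏ k, P (c k)) * F (c j) =
      ∏ k, P (c k) * (if k = j then F (c k) else 1) := by
    intro c
    rw [Finset.prod_mul_distrib]
    simp
  have h2 := Finset.prod_univ_sum (fun _ : ι => (Finset.univ : Finset κ))
    (fun k l => P l * (if k = j then F l else 1))
  rw [Fintype.piFinset_univ] at h2
  simp only [h1]
  rw [← h2, Finset.prod_eq_single j]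
  · simp
  · intro k _ hk
    simp [hk, hP]
  · simp

variable {d n q b : ℕ} {loss : Fin n → Fin q → Param d → ℝ}

theorem gradient_empiricalLoss (hdiff : ∀ i, Differentiable ℝ (instanceLoss loss i)) (x : Param d) :
    gradient (empiricalLoss loss) x = (1 / (n : ℝ)) • ∑ i, gradient (instanceLoss loss i) x := by
  have h : HasGradientAt (empiricalLoss loss)
      ((1 / (n : ℝ)) • ∑ i, gradient (instanceLoss loss i) x) x := by
    rw [hasGradientAt_iff_hasFDerivAt, map_smul, map_sum]
    refine HasFDerivAt.const_mul ?_ _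
    refine HasFDerivAt.fun_sum fun i _ => ?_
    exact ((hdiff i) x).hasGradientAt.hasFDerivAt
  exact h.gradient

theorem differentiable_empiricalLoss (hdiff : ∀ i, Differentiable ℝ (instanceLoss loss i)) :
    Differentiable ℝ (empiricalLoss loss) := by
  unfold empiricalLoss
  exact (Differentiable.fun_sum fun i _ => hdiff i).const_mul _

/-- The estimator is unbiased when the batch is drawn from the product distribution. -/
theorem sum_prod_smul_gradEstimator (hb : 0 < b)
    (hdiff : ∀ i, Differentiable ℝ (instanceLoss loss i)) {P : Fin n → ℝ} (hP : ∀ i, 0 < P i)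
    (hP1 : ∑ i, P i = 1) (x : Param d) :
    ∑ c : Fin b → Fin n, (∏ k, P (c k)) • gradEstimator loss P c x =
      gradient (empiricalLoss loss) x := by
  rw [gradient_empiricalLoss hdiff]
  ext l
  have hb' : (b : ℝ) ≠ 0 := by exact_mod_cast hb.ne'
  have key : ∀ k : Fin b, ∑ c : Fin b → Fin n, (∏ k, P (c k)) *
      ((1 / ((n : ℝ) * P (c k))) * gradient (instanceLoss loss (c k)) x l) =
      (1 / (n : ℝ)) * ∑ i, gradient (instanceLoss loss i) x l := by
    intro k
    rw [sum_prod_mul_apply hP1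
      (fun i => (1 / ((n : ℝ) * P i)) * gradient (instanceLoss loss i) x l) k, Finset.mul_sum]
    refine Finset.sum_congr rfl fun i _ => ?_
    have := (hP i).ne'
    rcases eq_or_ne (n : ℝ) 0 with h | h
    · simp [h]
    · field_simp
  simp only [gradEstimator, PiLp.smul_apply, WithLp.ofLp_sum, Finset.sum_apply, smul_eq_mul,
    WithLp.ofLp_smul, Pi.smul_apply]
  have : ∀ c : Fin b → Fin n, (∏ k, P (c k)) * ((1 / (b : ℝ)) * ∑ k,
      (1 / ((n : ℝ) * P (c k))) * gradient (instanceLoss loss (c k)) x l) =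
      (1 / (b : ℝ)) * ∑ k, (∏ k, P (c k)) *
      ((1 / ((n : ℝ) * P (c k))) * gradient (instanceLoss loss (c k)) x l) := by
    intro c
    rw [← Finset.mul_sum]; ring
  simp only [this]
  rw [← Finset.mul_sum, Finset.sum_comm]
  simp only [key]
  simp
  field_simp

theorem norm_gradEstimator_le (hn : 0 < n) (hb : 0 < b) {P : Fin n → ℝ} {c D : ℝ} (hc : 0 < c)
    (hP : ∀ i, c ≤ P i) {x : Param d} (hx : ∀ i, ‖gradient (instanceLoss loss i) x‖ ≤ D)
    (B : Fin b → Fin n) : ‖gradEstimator loss P B x‖ ≤ D / (n * c) := by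
  have hn' : (0 : ℝ) < n := by exact_mod_cast hn
  have hb' : (0 : ℝ) < b := by exact_mod_cast hb
  have h : ∀ k, ‖(1 / ((n : ℝ) * P (B k))) • gradient (instanceLoss loss (B k)) x‖ ≤
      D / (n * c) := by
    intro k
    have hPk : 0 < P (B k) := hc.trans_le (hP _)
    rw [norm_smul, Real.norm_of_nonneg (by positivity), div_eq_inv_mul D, ← one_div]
    have := hP (B k)
    exact mul_le_mul (by gcongr) (hx _) (norm_nonneg _) (by positivity)
  unfold gradEstimator
  rw [norm_smul, Real.norm_of_nonneg (by positivity)]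
  calc 1 / (b : ℝ) * ‖∑ k, (1 / ((n : ℝ) * P (B k))) • gradient (instanceLoss loss (B k)) x‖
      ≤ 1 / (b : ℝ) * ∑ _k : Fin b, D / (n * c) := by
        gcongr
        exact norm_sum_le_of_le _ fun k _ => h k
    _ = D / (n * c) := by simp; field_simp

theorem norm_gradient_empiricalLoss_le (hn : 0 < n)
    (hdiff : ∀ i, Differentiable ℝ (instanceLoss loss i)) {D : ℝ} {x : Param d}
    (hx : ∀ i, ‖gradient (instanceLoss loss i) x‖ ≤ D) :
    ‖gradient (empiricalLoss loss) x‖ ≤ D := by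
  have hn' : (0 : ℝ) < n := by exact_mod_cast hn
  rw [gradient_empiricalLoss hdiff, norm_smul, Real.norm_of_nonneg (by positivity)]
  calc 1 / (n : ℝ) * ‖∑ i, gradient (instanceLoss loss i) x‖
      ≤ 1 / (n : ℝ) * ∑ _i : Fin n, D := by
        gcongr
        exact norm_sum_le_of_le _ fun k _ => hx k
    _ = D := by simp; field_simp

theorem measurable_gradient (f : Param d → ℝ) : Measurable (gradient f) :=
  (InnerProductSpace.toDual ℝ (Param d)).symm.continuous.measurable.comp (measurable_fderiv ℝ f)

theorem measurable_gradEstimator (B : Fin b → Fin n) {Ω : Type*} {_ : MeasurableSpace Ω}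
    {P : Ω → Fin n → ℝ} {x : Ω → Param d} (hP : Measurable P) (hx : Measurable x) :
    Measurable fun ω => gradEstimator loss (P ω) B (x ω) := by
  unfold gradEstimator
  have h : ∀ k : Fin b, Measurable fun ω : Ω =>
      (1 / ((n : ℝ) * P ω (B k))) • gradient (instanceLoss loss (B k)) (x ω) := by
    intro k
    have h1 : Measurable fun ω : Ω => 1 / ((n : ℝ) * P ω (B k)) :=
      (((measurable_pi_apply (B k)).comp hP).const_mul _).const_div 1
    have h2 : Measurable fun ω : Ω => gradient (instanceLoss loss (B k)) (x ω) :=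
      (measurable_gradient _).comp hx
    exact h1.smul h2
  have h' : Measurable fun ω : Ω =>
      ∑ k, (1 / ((n : ℝ) * P ω (B k))) • gradient (instanceLoss loss (B k)) (x ω) :=
    Finset.measurable_fun_sum _ fun k _ => h k
  exact h'.const_smul (1 / (b : ℝ))

end Estimator

end D2ACE

/-! ### Adaptedness, conditional unbiasedness and uniform bounds for runs -/

namespace D2ACE

theorem measurable_param {d : ℕ} {Ω : Type*} {_ : MeasurableSpace Ω} {f : Ω → Param d}
    (h : ∀ k, Measurable fun ω => f ω k) : Measurable f :=
  (WithLp.measurable_toLp 2 (Fin d → ℝ)).comp (measurable_pi_lambda _ h)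

theorem measurable_param_apply {d : ℕ} {Ω : Type*} {_ : MeasurableSpace Ω} {f : Ω → Param d}
    (h : Measurable f) (k : Fin d) : Measurable fun ω => f ω k :=
  ((measurable_pi_apply k).comp (WithLp.measurable_ofLp 2 (Fin d → ℝ))).comp h

namespace Run

variable {d n q : ℕ} {loss : Fin n → Fin q → Param d → ℝ} {b : ℕ} {Δ W sMax : ℝ}
  {α β θ : ℕ → ℝ} {ε : ℝ} {x₁ : Param d} {Ω : Type*} [mΩ : MeasurableSpace Ω] {μ : Measure Ω}
  (R : Run loss b Δ W sMax α β θ ε x₁ μ)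

theorem le_prob {c : ℝ} (h : ∀ s ∈ Set.Icc 1 sMax, ∀ w : Fin n → ℝ, (∀ i, |w i| ≤ W) →
      ∀ i, c ≤ weightProb Δ s w i) {t : ℕ} (ht : 1 ≤ t) (ω : Ω) (i : Fin n) :
    c ≤ R.prob t ω i :=
  le_mixtureProb (R.p_mem t ht) (h _ (R.s_mem t ht) _ (R.wU_bounded t ht ω) i)
    (h _ (R.s_mem t ht) _ (R.wH_bounded t ht ω) i)

theorem measurable_prob {t : ℕ} (ht : 1 ≤ t) : Measurable[R.ℱ t] (R.prob t) := by
  refine @measurable_pi_lambda _ _ _ (R.ℱ t) _ _ fun i => ?_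
  have h1 := (measurable_weightProb Δ (R.s t) i).comp (R.wU_measurable t ht)
  have h2 := (measurable_weightProb Δ (R.s t) i).comp (R.wH_measurable t ht)
  exact (h1.const_mul _).add (h2.const_mul _)

/-- Splitting over the finitely many batches leaves, in each term, an indicator with known
conditional expectation times a vector determined by the past. -/
theorem g_eq_sum_indicator (t : ℕ) : R.g t = fun ω => ∑ c : Fin b → Fin n,
    ((R.B t ⁻¹' {c}).indicator (fun _ => (1 : ℝ)) ω) •
      gradEstimator loss (R.prob t ω) c (R.x t ω) := by
  funext ω
  rw [Finset.sum_eq_single (R.B t ω)]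
  · simp [g]
  · intro c _ hc
    simp [Set.indicator, hc.symm]
  · simp

theorem measurable_batchIndicator {t : ℕ} (ht : 1 ≤ t) (c : Fin b → Fin n) :
    Measurable[R.ℱ (t + 1)] ((R.B t ⁻¹' {c}).indicator (fun _ => (1 : ℝ))) :=
  Measurable.indicator (m := R.ℱ (t + 1)) measurable_const
    (R.B_measurable t ht (measurableSet_singleton c))

theorem measurable_gradEstimator_of_measurable {t : ℕ} (ht : 1 ≤ t)
    (hx : Measurable[R.ℱ t] (R.x t)) (c : Fin b → Fin n) :
    Measurable[R.ℱ t] fun ω => gradEstimator loss (R.prob t ω) c (R.x t ω) :=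
  measurable_gradEstimator c (R.measurable_prob ht) hx

theorem measurable_g_of_measurable {t : ℕ} (ht : 1 ≤ t) (hx : Measurable[R.ℱ t] (R.x t)) :
    Measurable[R.ℱ (t + 1)] (R.g t) := by
  rw [g_eq_sum_indicator]
  refine Finset.measurable_fun_sum _ fun c _ => ?_
  exact (R.measurable_batchIndicator ht c).smul
    ((R.measurable_gradEstimator_of_measurable ht hx c).mono (R.ℱ.mono t.le_succ) le_rfl)

/-- The index shift matters: `v t` is already known when the batch of iteration `t + 1` is drawn,
which makes the preconditioner of that iteration predictable. -/
theorem measurable_iterates (t : ℕ) : Measurable[R.ℱ (t + 1)] (R.x (t + 1)) ∧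
    Measurable[R.ℱ (t + 1)] (R.m t) ∧ Measurable[R.ℱ (t + 1)] (R.v t) := by
  induction t with
  | zero =>
    refine ⟨?_, measurable_param fun k => ?_, measurable_param fun k => ?_⟩
    · rw [show R.x (0 + 1) = fun _ => x₁ from funext R.x_init]
      exact measurable_const
    · simp only [R.m_init]
      exact measurable_const
    · simp only [R.v_init]
      exact measurable_const
  | succ t ih =>
    obtain ⟨hx, hm, hv⟩ := ih
    have hle : R.ℱ (t + 1) ≤ R.ℱ (t + 1 + 1) := R.ℱ.mono (t + 1).le_succ
    have hg := R.measurable_g_of_measurable (Nat.le_add_left 1 t) hx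
    have hx' := hx.mono hle le_rfl
    have hm' := hm.mono hle le_rfl
    have hv' := hv.mono hle le_rfl
    have hm2 : Measurable[R.ℱ (t + 1 + 1)] (R.m (t + 1)) := by
      refine measurable_param fun k => ?_
      simp only [R.m_step (t + 1) (Nat.le_add_left 1 t)]
      exact ((measurable_param_apply hm' k).const_mul _).add
        ((measurable_param_apply hg k).const_mul _)
    have hv2 : Measurable[R.ℱ (t + 1 + 1)] (R.v (t + 1)) := by
      refine measurable_param fun k => ?_
      simp only [R.v_step (t + 1) (Nat.le_add_left 1 t)]
      exact ((measurable_param_apply hv' k).const_mul _).add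
        (((measurable_param_apply hg k).pow_const 2).const_mul _)
    refine ⟨measurable_param fun k => ?_, hm2, hv2⟩
    simp only [R.x_step (t + 1) (Nat.le_add_left 1 t)]
    exact (measurable_param_apply hx' k).sub (((measurable_param_apply hm2 k).const_mul _).div
      (measurable_param_apply hv2 k).sqrt)

theorem measurable_x {t : ℕ} (ht : 1 ≤ t) : Measurable[R.ℱ t] (R.x t) := by
  obtain ⟨t, rfl⟩ := Nat.exists_eq_add_of_le' ht
  exact (R.measurable_iterates t).1

theorem measurable_g {t : ℕ} (ht : 1 ≤ t) : Measurable[R.ℱ (t + 1)] (R.g t) :=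
  R.measurable_g_of_measurable ht (R.measurable_x ht)

theorem gradBounded_norm_le {G : ℝ} (hG : R.GradBounded G) :
    ∀ᵐ ω ∂μ, ∀ t, 1 ≤ t → ∀ i, ‖gradient (instanceLoss loss i) (R.x t ω)‖ ≤ √G := by
  filter_upwards [hG] with ω h t ht i
  exact Real.le_sqrt_of_sq_le (h t ht i)

theorem ae_norm_g_le (hn : 0 < n) (hb : 0 < b) {c : ℝ} (hc : 0 < c)
    (h : ∀ s ∈ Set.Icc 1 sMax, ∀ w : Fin n → ℝ, (∀ i, |w i| ≤ W) →
      ∀ i, c ≤ weightProb Δ s w i) {G : ℝ} (hG : R.GradBounded G) :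
    ∀ᵐ ω ∂μ, ∀ t, 1 ≤ t → ∀ B : Fin b → Fin n,
      ‖gradEstimator loss (R.prob t ω) B (R.x t ω)‖ ≤ √G / (n * c) := by
  filter_upwards [R.gradBounded_norm_le hG] with ω hω t ht B
  exact norm_gradEstimator_le hn hb hc (R.le_prob h ht ω) (hω t ht) B

/-- The stochastic gradient is a conditionally unbiased estimator of the full gradient. -/
theorem condExp_g [IsProbabilityMeasure μ] (hn : 0 < n) (hb : 0 < b)
    (hdiff : ∀ i, Differentiable ℝ (instanceLoss loss i)) {c : ℝ} (hc : 0 < c)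
    (h : ∀ s ∈ Set.Icc 1 sMax, ∀ w : Fin n → ℝ, (∀ i, |w i| ≤ W) →
      ∀ i, c ≤ weightProb Δ s w i) {G : ℝ} (hG : R.GradBounded G) {t : ℕ} (ht : 1 ≤ t) :
    μ[R.g t | R.ℱ t] =ᵐ[μ] fun ω => gradient (empiricalLoss loss) (R.x t ω) := by
  have hbd := R.ae_norm_g_le hn hb hc h hG
  have hmeas := R.measurable_gradEstimator_of_measurable ht (R.measurable_x ht)
  have hind : ∀ B : Fin b → Fin n,
      Integrable ((R.B t ⁻¹' {B}).indicator (fun _ => (1 : ℝ))) μ := fun B =>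
    (integrable_const (1 : ℝ)).indicator
      ((R.ℱ.le (t + 1)) _ (R.B_measurable t ht (measurableSet_singleton B)))
  have hint : ∀ B : Fin b → Fin n, Integrable ((R.B t ⁻¹' {B}).indicator (fun _ => (1 : ℝ)) •
      fun ω => gradEstimator loss (R.prob t ω) B (R.x t ω)) μ := by
    intro B
    refine Integrable.of_bound (C := √G / (n * c)) ?_ ?_
    · exact (hind B).aestronglyMeasurable.smul
        ((hmeas B).mono (R.ℱ.le t) le_rfl).aestronglyMeasurable
    · filter_upwards [hbd] with ω hω
      have h0 := hω t ht B
      simp only [Pi.smul_apply', Set.indicator]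
      split_ifs
      · simpa using h0
      · simpa using (norm_nonneg _).trans h0
  have hterm : ∀ B : Fin b → Fin n, μ[(R.B t ⁻¹' {B}).indicator (fun _ => (1 : ℝ)) •
      fun ω => gradEstimator loss (R.prob t ω) B (R.x t ω) | R.ℱ t] =ᵐ[μ]
      fun ω => (∏ k, R.prob t ω (B k)) • gradEstimator loss (R.prob t ω) B (R.x t ω) := by
    intro B
    refine (condExp_smul_of_aestronglyMeasurable_right (hind B) (hint B)
      (hmeas B).stronglyMeasurable.aestronglyMeasurable).trans ?_
    filter_upwards [R.B_law t ht B] with ω hω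
    rw [Pi.smul_apply', hω]
    rfl
  have hsum : R.g t = ∑ B : Fin b → Fin n, (R.B t ⁻¹' {B}).indicator (fun _ => (1 : ℝ)) •
      fun ω => gradEstimator loss (R.prob t ω) B (R.x t ω) := by
    rw [g_eq_sum_indicator]
    funext ω
    simp [Finset.sum_apply]
  rw [hsum]
  refine (condExp_finsetSum (fun B _ => hint B) _).trans ?_
  have hall := ae_all_iff.2 hterm
  filter_upwards [hall] with ω hω
  rw [Finset.sum_apply]
  simp only [hω]
  exact sum_prod_smul_gradEstimator hb hdiff (fun i => hc.trans_le (R.le_prob h ht ω i))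
    (sum_mixtureProb hn) _

end Run

/-- Uniform bounds for the sampling probabilities and for the gradients of all runs. -/
theorem exists_uniform_bounds {d n q b : ℕ} (hn : 0 < n) (hb : 0 < b)
    (loss : Fin n → Fin q → Param d → ℝ)
    (hdiff : ∀ i, Differentiable ℝ (instanceLoss loss i))
    (G Δ W sMax ε : ℝ) (hΔ : 0 < Δ) (x₁ : Param d) :
    ∃ M : ℝ, 0 < M ∧ ∀ (α β θ : ℕ → ℝ) (Ω : Type*) [MeasurableSpace Ω] (μ : Measure Ω)
      [IsProbabilityMeasure μ] (R : Run loss b Δ W sMax α β θ ε x₁ μ), R.GradBounded G →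
      (∀ t, 1 ≤ t → ∀ ω i, 0 < R.prob t ω i) ∧
      (∀ t, 1 ≤ t → μ[R.g t | R.ℱ t] =ᵐ[μ]
        fun ω => gradient (empiricalLoss loss) (R.x t ω)) ∧
      ∀ᵐ ω ∂μ, ∀ t, 1 ≤ t → ‖R.g t ω‖ ≤ M ∧ ‖gradient (empiricalLoss loss) (R.x t ω)‖ ≤ M := by
  obtain ⟨c, hc, h⟩ := exists_weightProb_lower_bound hn hΔ W sMax
  have hn' : (0 : ℝ) < n := by exact_mod_cast hn
  -- The summand 1 only makes the bound strictly positive, also for `G ≤ 0`.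
  refine ⟨√G / (n * c) + √G + 1, by positivity, ?_⟩
  intro α β θ Ω _ μ _ R hG
  refine ⟨fun t ht ω i => hc.trans_le (R.le_prob h ht ω i),
    fun t ht => R.condExp_g hn hb hdiff hc h hG ht, ?_⟩
  filter_upwards [R.ae_norm_g_le hn hb hc h hG, R.gradBounded_norm_le hG] with ω h1 h2 t ht
  have h3 : 0 ≤ √G / (n * c) := by positivity
  constructor
  · have := h1 t ht (R.B t ω)
    unfold Run.g
    linarith [Real.sqrt_nonneg G]
  · linarith [norm_gradient_empiricalLoss_le hn hdiff (h2 t ht)]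

end D2ACE

/-! ### Discounted recursions -/

namespace D2ACE

section Sequences

theorem sum_le_of_discounted {X Y : ℕ → ℝ} {β : ℝ} (hβ : 0 ≤ β) (hβ1 : β < 1) (hX0 : X 0 = 0)
    (hX : ∀ t, 0 ≤ X t) (h : ∀ t, X (t + 1) ≤ β * X t + Y (t + 1)) (T : ℕ) :
    ∑ t ∈ range T, X (t + 1) ≤ (∑ t ∈ range T, Y (t + 1)) / (1 - β) := by
  have key : (1 - β) * ∑ t ∈ range T, X (t + 1) + β * X T ≤ ∑ t ∈ range T, Y (t + 1) := by
    induction T with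
    | zero => simp [hX0]
    | succ T ih =>
      rw [sum_range_succ, sum_range_succ]
      linarith [h T]
  rw [le_div_iff₀ (by linarith)]
  linarith [mul_nonneg hβ (hX T)]

/-- Non-increasing weights preserve the recursion: a_{t+1} β X_t ≤ β (a_t X_t), so the unweighted
case applies to the products. -/
theorem weighted_sum_le_of_discounted {a X Y : ℕ → ℝ} {β : ℝ} (hβ : 0 ≤ β) (hβ1 : β < 1)
    (ha : Antitone a) (ha0 : ∀ t, 0 ≤ a t) (hX0 : X 0 = 0)
    (hX : ∀ t, 0 ≤ X t) (h : ∀ t, X (t + 1) ≤ β * X t + Y (t + 1)) (T : ℕ) :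
    ∑ t ∈ range T, a (t + 1) * X (t + 1) ≤ (∑ t ∈ range T, a (t + 1) * Y (t + 1)) / (1 - β) := by
  refine sum_le_of_discounted (X := fun t => a t * X t) (Y := fun t => a t * Y t) hβ hβ1
    (by simp [hX0]) (fun t => mul_nonneg (ha0 t) (hX t)) (fun t => ?_) T
  have h1 := mul_le_mul_of_nonneg_left (h t) (ha0 (t + 1))
  have h2 := mul_le_mul_of_nonneg_right (ha t.le_succ) (mul_nonneg hβ (hX t))
  simp only [Nat.succ_eq_add_one] at h2
  linarith

/-- The factors may exceed 1 for finitely many indices and are at most some ρ < 1 afterwards. The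
bound depends on `c` alone, so it serves all trajectories at once. -/
theorem exists_bound_of_contraction {c : ℕ → ℝ} {β : ℝ} (hc : ∀ t, 0 ≤ c t)
    (hlim : Tendsto c atTop (𝓝 β)) (hβ : β < 1) :
    ∃ H : ℝ, 0 < H ∧ ∀ X : ℕ → ℝ, X 0 ≤ 0 → (∀ t, X (t + 1) ≤ c (t + 1) * X t + 1) →
      ∀ t, X t ≤ H := by
  obtain ⟨ρ, hβρ, hρ1⟩ := exists_between hβ
  have hρ1' : 0 < 1 - ρ := by linarith
  obtain ⟨N, hN⟩ := eventually_atTop.1 (hlim.eventually_le_const hβρ)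
  have hρ0 : 0 ≤ ρ := (hc N).trans (hN N le_rfl)
  -- The extremal solution, with equality in the recursion, dominates every admissible `X`.
  let Y : ℕ → ℝ := fun t => Nat.rec 0 (fun t y => c (t + 1) * y + 1) t
  have hYs : ∀ t, Y (t + 1) = c (t + 1) * Y t + 1 := fun t => rfl
  have hY0 : ∀ t, 0 ≤ Y t := by
    intro t
    induction t with
    | zero => exact le_rfl
    | succ t ih => rw [hYs]; have := mul_nonneg (hc (t + 1)) ih; linarith
  have hYsum : ∀ t, t ≤ N → Y t ≤ ∑ i ∈ range (N + 1), Y i := fun t ht =>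
    single_le_sum (f := Y) (fun i _ => hY0 i) (mem_range.2 (by omega))
  have hsum0 : 0 ≤ ∑ i ∈ range (N + 1), Y i := sum_nonneg fun i _ => hY0 i
  -- 1/(1-ρ) is the fixed point of y ↦ ρ y + 1, so this bound is invariant once the factors are at
  -- most ρ.
  have hYN : ∀ k, Y (N + k) ≤ ∑ i ∈ range (N + 1), Y i + 1 / (1 - ρ) := by
    intro k
    induction k with
    | zero =>
      have := hYsum N le_rfl
      have h2 : 0 < 1 / (1 - ρ) := by positivity
      simp only [add_zero]; linarith
    | succ k ih =>
      rw [← add_assoc, hYs]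
      have h1 : c (N + k + 1) * Y (N + k) ≤ ρ * (∑ i ∈ range (N + 1), Y i + 1 / (1 - ρ)) :=
        mul_le_mul (hN _ (by omega)) ih (hY0 _) hρ0
      have h2 : ρ * (1 / (1 - ρ)) + 1 = 1 / (1 - ρ) := by field_simp; ring
      nlinarith [mul_le_mul_of_nonneg_right hρ1.le hsum0]
  refine ⟨∑ i ∈ range (N + 1), Y i + 1 / (1 - ρ), by positivity, fun X hX0 hX t => ?_⟩
  have hXY : X t ≤ Y t := by
    induction t with
    | zero => exact hX0
    | succ t ih =>
      rw [hYs]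
      linarith [hX t, mul_le_mul_of_nonneg_left ih (hc (t + 1))]
  refine hXY.trans ?_
  rcases le_total t N with ht | ht
  · have h2 : 0 < 1 / (1 - ρ) := by positivity
    linarith [hYsum t ht]
  · obtain ⟨k, rfl⟩ := Nat.exists_eq_add_of_le ht
    exact hYN k

end Sequences

/-! ### Parameter conditions and energy estimates in one coordinate -/

/-- The parameter conditions of generic Adam, for sequences that are indexed from `0`. -/
structure AdamParams (α β θ a : ℕ → ℝ) (β₀ C₀ : ℝ) : Prop where
  alpha_pos : ∀ t, 0 < α t
  beta_nonneg : ∀ t, 0 ≤ β t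
  beta_le : ∀ t, β t ≤ β₀
  beta_lt : β₀ < 1
  theta_pos : ∀ t, 0 < θ t
  theta_lt : ∀ t, θ t < 1
  theta_mono : Monotone θ
  theta_tendsto : Tendsto θ atTop (𝓝 1)
  anti : Antitone a
  C_pos : 0 < C₀
  le_alpha : ∀ t, a t * √(1 - θ t) ≤ α t
  alpha_le : ∀ t, α t ≤ C₀ * (a t * √(1 - θ t))

namespace AdamParams

variable {α β θ a : ℕ → ℝ} {β₀ C₀ : ℝ} (P : AdamParams α β θ a β₀ C₀)
include P

theorem beta₀_nonneg : 0 ≤ β₀ := (P.beta_nonneg 0).trans (P.beta_le 0)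

theorem sqrt_pos (t : ℕ) : 0 < √(1 - θ t) := Real.sqrt_pos.2 (by linarith [P.theta_lt t])

theorem sq_sqrt (t : ℕ) : √(1 - θ t) ^ 2 = 1 - θ t := Real.sq_sqrt (by linarith [P.theta_lt t])

theorem sqrt_anti : Antitone fun t => √(1 - θ t) := fun s t hst =>
  Real.sqrt_le_sqrt (by linarith [P.theta_mono hst])

theorem a_pos (t : ℕ) : 0 < a t := by
  have h := (P.alpha_pos t).trans_le (P.alpha_le t)
  exact pos_of_mul_pos_left (pos_of_mul_pos_right h P.C_pos.le) (P.sqrt_pos t).le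

theorem step_anti : Antitone fun t => a t * √(1 - θ t) := fun s t hst =>
  mul_le_mul (P.anti hst) (P.sqrt_anti hst) (P.sqrt_pos t).le (P.a_pos s).le

theorem step_pos (t : ℕ) : 0 < a t * √(1 - θ t) := mul_pos (P.a_pos t) (P.sqrt_pos t)

end AdamParams

/-- The second- and first-moment recursions in one coordinate. -/
structure ScalarAdam (β θ : ℕ → ℝ) (ε M : ℝ) (g m v : ℕ → ℝ) : Prop where
  m_zero : m 0 = 0
  v_zero : v 0 = ε
  m_succ : ∀ t, m (t + 1) = β (t + 1) * m t + (1 - β (t + 1)) * g (t + 1)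
  v_succ : ∀ t, v (t + 1) = θ (t + 1) * v t + (1 - θ (t + 1)) * g (t + 1) ^ 2
  bound : ∀ t, |g (t + 1)| ≤ M

namespace ScalarAdam

variable {α β θ a : ℕ → ℝ} {β₀ C₀ ε M : ℝ} {g m v : ℕ → ℝ}

section
variable (S : ScalarAdam β θ ε M g m v) (P : AdamParams α β θ a β₀ C₀) (hε : 0 < ε)
include S P hε

theorem v_pos (t : ℕ) : 0 < v t := by
  induction t with
  | zero => rw [S.v_zero]; exact hε
  | succ t ih =>
    rw [S.v_succ]
    have h1 := mul_pos (P.theta_pos (t + 1)) ih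
    have h2 := mul_nonneg (sub_nonneg.2 (P.theta_lt (t + 1)).le) (sq_nonneg (g (t + 1)))
    linarith

omit hε P in
theorem g_sq_le (t : ℕ) : g (t + 1) ^ 2 ≤ M ^ 2 := by
  rw [← sq_abs]
  exact pow_le_pow_left₀ (abs_nonneg _) (S.bound t) 2

theorem v_le (t : ℕ) : v t ≤ ε + M ^ 2 := by
  induction t with
  | zero => rw [S.v_zero]; nlinarith [sq_nonneg M]
  | succ t ih =>
    rw [S.v_succ]
    have h1 := mul_le_mul_of_nonneg_left ih (P.theta_pos (t + 1)).le
    have h2 := mul_le_mul_of_nonneg_left (S.g_sq_le t) (sub_nonneg.2 (P.theta_lt (t + 1)).le)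
    have h4 : (1 - θ (t + 1)) * M ^ 2 ≤ (1 - θ (t + 1)) * (ε + M ^ 2) := by
      refine mul_le_mul_of_nonneg_left ?_ (sub_nonneg.2 (P.theta_lt (t + 1)).le)
      linarith [hε]
    linarith

theorem v_ratio (t : ℕ) : θ (t + 1) * v t / v (t + 1) =
    1 - (1 - θ (t + 1)) * g (t + 1) ^ 2 / v (t + 1) := by
  have h := S.v_pos P hε (t + 1)
  rw [eq_sub_iff_add_eq, ← add_div, ← S.v_succ, div_self h.ne']

theorem e_nonneg (t : ℕ) : 0 ≤ (1 - θ t) * g t ^ 2 / v t :=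
  div_nonneg (mul_nonneg (sub_nonneg.2 (P.theta_lt t).le) (sq_nonneg _)) (S.v_pos P hε t).le

theorem e_le_one (t : ℕ) : (1 - θ (t + 1)) * g (t + 1) ^ 2 / v (t + 1) ≤ 1 := by
  have h := S.v_ratio P hε t
  have : 0 ≤ θ (t + 1) * v t / v (t + 1) :=
    div_nonneg (mul_nonneg (P.theta_pos _).le (S.v_pos P hε t).le) (S.v_pos P hε _).le
  linarith

/-- By `v_ratio` the energy is 1 - y with y = θ v_t / v_{t+1}, and 1 - y ≤ -log y. The remaining
-log θ is at most (1-θ)/θ. -/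
theorem e_le_log (t : ℕ) : (1 - θ (t + 1)) * g (t + 1) ^ 2 / v (t + 1) ≤
    Real.log (v (t + 1)) - Real.log (v t) + (1 - θ (t + 1)) / θ 0 := by
  have hv := S.v_pos P hε t
  have hv' := S.v_pos P hε (t + 1)
  have hθ := P.theta_pos (t + 1)
  have h1 := Real.log_le_sub_one_of_pos (div_pos (mul_pos hθ hv) hv')
  rw [Real.log_div (mul_pos hθ hv).ne' hv'.ne', Real.log_mul hθ.ne' hv.ne', S.v_ratio P hε t] at h1
  have h2 := Real.log_le_sub_one_of_pos (inv_pos.2 hθ)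
  rw [Real.log_inv] at h2
  have h3 : (θ (t + 1))⁻¹ - 1 = (1 - θ (t + 1)) / θ (t + 1) := by field_simp
  have h4 : (1 - θ (t + 1)) / θ (t + 1) ≤ (1 - θ (t + 1)) / θ 0 :=
    div_le_div_of_nonneg_left (by linarith [P.theta_lt (t + 1)]) (P.theta_pos 0)
      (P.theta_mono (Nat.zero_le _))
  linarith

theorem sum_e_le (T : ℕ) :
    ∑ t ∈ range T, a (t + 1) * ((1 - θ (t + 1)) * g (t + 1) ^ 2 / v (t + 1)) ≤
      a 0 * (Real.log (ε + M ^ 2) - Real.log ε) +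
        (∑ t ∈ range T, a (t + 1) * (1 - θ (t + 1))) / θ 0 := by
  -- Summation by parts as an induction: the subtracted boundary term is nonnegative because v_T ≤ ε
  -- + M², so lowering its weight from a_T to a_{T+1} is harmless.
  have key : ∑ t ∈ range T, a (t + 1) * ((1 - θ (t + 1)) * g (t + 1) ^ 2 / v (t + 1)) ≤
      a 0 * (Real.log (ε + M ^ 2) - Real.log ε) - a T * (Real.log (ε + M ^ 2) - Real.log (v T)) +
        (∑ t ∈ range T, a (t + 1) * (1 - θ (t + 1))) / θ 0 := by
    induction T with
    | zero => simp [S.v_zero]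
    | succ T ih =>
      rw [sum_range_succ, sum_range_succ, add_div]
      have h1 := mul_le_mul_of_nonneg_left (S.e_le_log P hε T) (P.a_pos (T + 1)).le
      have h2 : 0 ≤ Real.log (ε + M ^ 2) - Real.log (v T) :=
        sub_nonneg.2 (Real.log_le_log (S.v_pos P hε T) (S.v_le P hε T))
      have h3 := mul_le_mul_of_nonneg_right (P.anti T.le_succ) h2
      simp only [Nat.succ_eq_add_one] at h3
      have h4 : a (T + 1) * (1 - θ (T + 1)) / θ 0 = a (T + 1) * ((1 - θ (T + 1)) / θ 0) := by ring
      rw [h4]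
      linarith
  have h2 : 0 ≤ a T * (Real.log (ε + M ^ 2) - Real.log (v T)) :=
    mul_nonneg (P.a_pos T).le
      (sub_nonneg.2 (Real.log_le_log (S.v_pos P hε T) (S.v_le P hε T)))
  linarith

theorem h_nonneg (t : ℕ) : 0 ≤ (1 - θ t) * m t ^ 2 / v t :=
  div_nonneg (mul_nonneg (sub_nonneg.2 (P.theta_lt t).le) (sq_nonneg _)) (S.v_pos P hε t).le

/-- Convexity of the square handles the average defining m_{t+1}. The old part then uses v_{t+1} ≥ θ
v_t, and the monotonicity of θ moves the prefactor back to index t. -/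
theorem h_step (t : ℕ) : (1 - θ (t + 1)) * m (t + 1) ^ 2 / v (t + 1) ≤
    β₀ / θ (t + 1) * ((1 - θ t) * m t ^ 2 / v t) +
      (1 - θ (t + 1)) * g (t + 1) ^ 2 / v (t + 1) := by
  have hv := S.v_pos P hε t
  have hv' := S.v_pos P hε (t + 1)
  have hθ := P.theta_pos (t + 1)
  have hθ1 : 0 ≤ 1 - θ (t + 1) := by linarith [P.theta_lt (t + 1)]
  have hb := P.beta_nonneg (t + 1)
  have hb1 := P.beta_le (t + 1)
  have hb2 := P.beta_lt
  have hm : m (t + 1) ^ 2 ≤ β₀ * m t ^ 2 + g (t + 1) ^ 2 := by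
    rw [S.m_succ]
    have h1 : (β (t + 1) * m t + (1 - β (t + 1)) * g (t + 1)) ^ 2 =
        β (t + 1) * m t ^ 2 + (1 - β (t + 1)) * g (t + 1) ^ 2 -
          β (t + 1) * (1 - β (t + 1)) * (m t - g (t + 1)) ^ 2 := by ring
    have h2 : 0 ≤ β (t + 1) * (1 - β (t + 1)) * (m t - g (t + 1)) ^ 2 :=
      mul_nonneg (mul_nonneg hb (by linarith)) (sq_nonneg _)
    have h3 := mul_le_mul_of_nonneg_right hb1 (sq_nonneg (m t))
    have h4 := mul_nonneg hb (sq_nonneg (g (t + 1)))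
    linarith
  have hvv : θ (t + 1) * v t ≤ v (t + 1) := by
    rw [S.v_succ]
    linarith [mul_nonneg hθ1 (sq_nonneg (g (t + 1)))]
  calc (1 - θ (t + 1)) * m (t + 1) ^ 2 / v (t + 1)
      ≤ (1 - θ (t + 1)) * (β₀ * m t ^ 2 + g (t + 1) ^ 2) / v (t + 1) := by gcongr
    _ = (1 - θ (t + 1)) * (β₀ * m t ^ 2) / v (t + 1) +
        (1 - θ (t + 1)) * g (t + 1) ^ 2 / v (t + 1) := by rw [← add_div]; ring
    _ ≤ (1 - θ t) * (β₀ * m t ^ 2) / (θ (t + 1) * v t) +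
        (1 - θ (t + 1)) * g (t + 1) ^ 2 / v (t + 1) := by
      have h5 := P.theta_mono t.le_succ
      have h6 : 0 ≤ β₀ * m t ^ 2 := mul_nonneg P.beta₀_nonneg (sq_nonneg _)
      have h7 : 0 ≤ 1 - θ t := by linarith [P.theta_lt t]
      simp only [Nat.succ_eq_add_one] at h5
      gcongr
    _ = _ := by field_simp

end

/-- A uniform bound for the normalized first moments. -/
theorem exists_h_le (P : AdamParams α β θ a β₀ C₀) (hε : 0 < ε) :
    ∃ H : ℝ, 0 < H ∧ ∀ g m v : ℕ → ℝ, ScalarAdam β θ ε M g m v →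
      ∀ t, (1 - θ t) * m t ^ 2 / v t ≤ H := by
  have hlim : Tendsto (fun t => β₀ / θ t) atTop (𝓝 β₀) := by
    have h := (tendsto_const_nhds (x := β₀)).div P.theta_tendsto one_ne_zero
    rw [div_one] at h
    exact h
  obtain ⟨H, hH, h⟩ := exists_bound_of_contraction
    (fun t => div_nonneg P.beta₀_nonneg (P.theta_pos t).le) hlim P.beta_lt
  refine ⟨H, hH, fun g m v S => h _ (by simp [S.m_zero]) fun t => ?_⟩
  linarith [S.h_step P hε t, S.e_le_one P hε t]

/-- The factor β₀/θ may exceed 1 at first. Its excess over β₀ is O(1-θ), and multiplied by the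
uniform bound `H` it becomes a source term, leaving the genuine discount β₀. -/
theorem sum_h_le (S : ScalarAdam β θ ε M g m v) (P : AdamParams α β θ a β₀ C₀) (hε : 0 < ε)
    {H : ℝ} (hH : ∀ t, (1 - θ t) * m t ^ 2 / v t ≤ H) (T : ℕ) :
    ∑ t ∈ range T, a (t + 1) * ((1 - θ (t + 1)) * m (t + 1) ^ 2 / v (t + 1)) ≤
      (∑ t ∈ range T, a (t + 1) * ((1 - θ (t + 1)) * g (t + 1) ^ 2 / v (t + 1)) +
        H / θ 0 * ∑ t ∈ range T, a (t + 1) * (1 - θ (t + 1))) / (1 - β₀) := by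
  have h := weighted_sum_le_of_discounted (a := a) (X := fun t => (1 - θ t) * m t ^ 2 / v t)
    (Y := fun t => (1 - θ t) * g t ^ 2 / v t + H / θ 0 * (1 - θ t)) P.beta₀_nonneg P.beta_lt
    P.anti (fun t => (P.a_pos t).le) (by simp [S.m_zero]) (S.h_nonneg P hε) (fun t => ?_) T
  · simp only [mul_add, sum_add_distrib] at h
    convert h using 3
    rw [mul_sum]
    exact sum_congr rfl fun t _ => by ring
  · have h1 := S.h_step P hε t
    have hθ := P.theta_pos (t + 1)
    have hθ1 : 0 ≤ 1 - θ (t + 1) := by linarith [P.theta_lt (t + 1)]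
    have h2 : β₀ / θ (t + 1) = β₀ + β₀ * ((1 - θ (t + 1)) / θ (t + 1)) := by field_simp; ring
    have h3 : β₀ * ((1 - θ (t + 1)) / θ (t + 1)) ≤ 1 * ((1 - θ (t + 1)) / θ 0) := by
      refine mul_le_mul P.beta_lt.le ?_ (by positivity) zero_le_one
      exact div_le_div_of_nonneg_left hθ1 (P.theta_pos 0) (P.theta_mono (Nat.zero_le _))
    have h4 : β₀ * ((1 - θ (t + 1)) / θ (t + 1)) * ((1 - θ t) * m t ^ 2 / v t) ≤
        1 * ((1 - θ (t + 1)) / θ 0) * H :=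
      mul_le_mul h3 (hH t) (S.h_nonneg P hε t)
        (by rw [one_mul]; exact div_nonneg hθ1 (P.theta_pos 0).le)
    rw [h2] at h1
    have h5 : 1 * ((1 - θ (t + 1)) / θ 0) * H = H / θ 0 * (1 - θ (t + 1)) := by ring
    linarith

end ScalarAdam

end D2ACE

/-! ### One-step lower bounds for the update direction in one coordinate -/

namespace D2ACE

namespace ScalarAdam

variable {α β θ a : ℕ → ℝ} {β₀ C₀ ε M : ℝ} {g m v : ℕ → ℝ}
  (S : ScalarAdam β θ ε M g m v) (P : AdamParams α β θ a β₀ C₀) (hε : 0 < ε)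
include S P hε

/-- Replacing the current second moment by its predictable upper bound. -/
theorem gradient_term_ge (hM : 0 < M) (D : ℝ) (t : ℕ) :
    D * g (t + 1) / √(θ (t + 1) * v t + (1 - θ (t + 1)) * M ^ 2) -
      D ^ 2 / √(θ (t + 1) * v t + (1 - θ (t + 1)) * M ^ 2) / 2 -
      M / 2 * ((1 - θ (t + 1)) * g (t + 1) ^ 2 / v (t + 1) / √(1 - θ (t + 1))) ≤
    D * g (t + 1) / √(v (t + 1)) := by
  have hv := S.v_pos P hε t
  have hv' := S.v_pos P hε (t + 1)
  have hθ := P.theta_pos (t + 1)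
  have hw := P.sqrt_pos (t + 1)
  have hw2 := P.sq_sqrt (t + 1)
  have hs : 0 < √(v (t + 1)) := Real.sqrt_pos.2 hv'
  have hs2 : √(v (t + 1)) ^ 2 = v (t + 1) := Real.sq_sqrt hv'.le
  set w := √(1 - θ (t + 1))
  set s := √(v (t + 1))
  set u := θ (t + 1) * v t + (1 - θ (t + 1)) * M ^ 2 with hu
  have hu0 : 0 < u := by
    rw [hu, ← hw2]; positivity
  have hp : 0 < √u := Real.sqrt_pos.2 hu0
  have hp2 : √u ^ 2 = u := Real.sq_sqrt hu0.le
  have hvu : v (t + 1) ≤ u := by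
    rw [S.v_succ, hu, ← hw2]
    nlinarith [mul_le_mul_of_nonneg_left (S.g_sq_le t) (sq_nonneg w)]
  have hsp : s ≤ √u := Real.sqrt_le_sqrt hvu
  have hwM : w * M ≤ √u := by
    refine Real.le_sqrt_of_sq_le ?_
    rw [mul_pow, hw2, hu]
    linarith [mul_pos hθ hv]
  set p := √u
  have hps : p - s ≤ w * M := by
    have h1 : p ^ 2 - s ^ 2 ≤ w ^ 2 * M ^ 2 := by
      rw [hp2, hs2, hw2, S.v_succ, hu]
      have : 0 ≤ (1 - θ (t + 1)) * g (t + 1) ^ 2 := by rw [← hw2]; positivity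
      linarith
    -- Since s > 0, p - s > wM would give p² - s² ≥ (p - s)² > (wM)².
    by_contra hcon
    push Not at hcon
    have h2 : 0 < w * M := mul_pos hw hM
    nlinarith
  set γ := g (t + 1) / s with hγ
  have hge : (1 - θ (t + 1)) * g (t + 1) ^ 2 / v (t + 1) / w = w * γ ^ 2 := by
    rw [← hw2, ← hs2, hγ]; field_simp
  have hDs : D * g (t + 1) / s = D * γ := by rw [hγ]; ring
  have hDp : D * g (t + 1) / p = D * γ - D * γ * (p - s) / p := by rw [hγ]; field_simp; ring
  rw [hge, hDs, hDp]
  have h3 : -(D * γ * (p - s) / p) ≤ |D| * |γ| * (w * M) / p := by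
    rw [← neg_div]
    refine div_le_div_of_nonneg_right ?_ hp.le
    calc -(D * γ * (p - s)) ≤ |D * γ * (p - s)| := neg_le_abs _
      _ = |D| * |γ| * (p - s) := by rw [abs_mul, abs_mul, abs_of_nonneg (sub_nonneg.2 hsp)]
      _ ≤ |D| * |γ| * (w * M) := by gcongr
  -- Young's inequality: the first half is paid from the main term D²/p, of which half survives. The
  -- second half becomes an energy once wM ≤ p cancels one factor.
  have h4 : |D| * |γ| * (w * M) / p ≤ D ^ 2 / p / 2 + γ ^ 2 * (w * M) ^ 2 / p / 2 := by

    rw [← add_div, ← add_div, div_div, mul_comm p 2, ← div_div]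
    refine div_le_div_of_nonneg_right ?_ hp.le
    nlinarith [sq_nonneg (|D| - |γ| * (w * M)), sq_abs D, sq_abs γ]
  have h5 : γ ^ 2 * (w * M) ^ 2 / p ≤ γ ^ 2 * (w * M) := by
    rw [div_le_iff₀ hp]
    have h6 : 0 ≤ γ ^ 2 * (w * M) := by positivity
    nlinarith [mul_le_mul_of_nonneg_left hwM h6]
  linarith

/-- The change of the second moment in the momentum term. -/
theorem momentum_term_ge {H : ℝ} (hM : 0 < M) (hH : ∀ t, (1 - θ t) * m t ^ 2 / v t ≤ H)
    {D : ℝ} (hD : |D| ≤ M) (t : ℕ) :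
    D * m t / √(v t) - M * √H / θ 0 * (√(1 - θ (t + 1)) +
      (1 - θ (t + 1)) * g (t + 1) ^ 2 / v (t + 1) / √(1 - θ (t + 1))) ≤
    D * m t / √(v (t + 1)) := by
  have hv := S.v_pos P hε t
  have hv' := S.v_pos P hε (t + 1)
  have hθ := P.theta_pos (t + 1)
  have hw := P.sqrt_pos (t + 1)
  have hw2 := P.sq_sqrt (t + 1)
  have hs : 0 < √(v t) := Real.sqrt_pos.2 hv
  have hs' : 0 < √(v (t + 1)) := Real.sqrt_pos.2 hv'
  have he := S.v_ratio P hε t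
  have he0 := S.e_nonneg P hε (t + 1)
  set e := (1 - θ (t + 1)) * g (t + 1) ^ 2 / v (t + 1)
  have hwt : √(1 - θ (t + 1)) ≤ √(1 - θ t) := P.sqrt_anti t.le_succ
  have hmH : |m t| / √(v t) ≤ √H / √(1 - θ (t + 1)) := by
    have h1 : √(1 - θ t) * (|m t| / √(v t)) ≤ √H := by
      refine Real.le_sqrt_of_sq_le ?_
      rw [mul_pow, div_pow, sq_abs, P.sq_sqrt, Real.sq_sqrt hv.le, ← mul_div_assoc]
      exact hH t
    rw [le_div_iff₀ hw, mul_comm]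
    exact (mul_le_mul_of_nonneg_right hwt (by positivity)).trans h1
  set w := √(1 - θ (t + 1))
  set y := √(v t) / √(v (t + 1)) with hy
  have hy0 : 0 < y := div_pos hs hs'
  have hy2 : y ^ 2 = (1 - e) / θ (t + 1) := by
    rw [hy, div_pow, Real.sq_sqrt hv.le, Real.sq_sqrt hv'.le, ← he]
    field_simp
  -- As y > 0, |y - 1| ≤ |y² - 1|, and y² is explicit by `v_ratio`. Division by w in `hmH` then
  -- produces the errors w and e/w.
  have hy1 : |y - 1| ≤ (w ^ 2 + e) / θ 0 := by
    have h1 : |y - 1| ≤ |y ^ 2 - 1| := by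
      rw [show y ^ 2 - 1 = (y - 1) * (y + 1) by ring, abs_mul, abs_of_pos (by linarith : 0 < y + 1)]
      nlinarith [abs_nonneg (y - 1)]
    have h2 : y ^ 2 - 1 = (w ^ 2 - e) / θ (t + 1) := by
      rw [hy2, hw2]; field_simp; ring
    have h3 : |w ^ 2 - e| ≤ w ^ 2 + e := by
      rw [abs_le]; constructor <;> nlinarith [sq_nonneg w]
    refine h1.trans ?_
    rw [h2, abs_div, abs_of_pos hθ]
    exact div_le_div₀ (by positivity) h3 (P.theta_pos 0) (P.theta_mono (Nat.zero_le _))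
  have hdiff : D * m t / √(v (t + 1)) = D * m t / √(v t) + D * (m t / √(v t)) * (y - 1) := by
    rw [hy]; field_simp; ring
  have hbound : |D * (m t / √(v t)) * (y - 1)| ≤ M * (√H / w) * ((w ^ 2 + e) / θ 0) := by
    rw [abs_mul, abs_mul, abs_div, abs_of_pos hs]
    have : 0 ≤ √H / w := by positivity
    gcongr
  have heq : M * (√H / w) * ((w ^ 2 + e) / θ 0) = M * √H / θ 0 * (w + e / w) := by
    have := P.theta_pos 0
    field_simp
  rw [hdiff]
  linarith [neg_abs_le (D * (m t / √(v t)) * (y - 1))]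

/-- One step of the recursion for the inner product of gradient and update direction. -/
theorem direction_step {H : ℝ} (hM : 0 < M) (hH : ∀ t, (1 - θ t) * m t ^ 2 / v t ≤ H)
    {D : ℝ} (hD : |D| ≤ M) (t : ℕ) :
    β (t + 1) * (D * (m t / √(v t))) + (1 - β (t + 1)) *
      (D / √(θ (t + 1) * v t + (1 - θ (t + 1)) * M ^ 2) * g (t + 1) -
      D / √(θ (t + 1) * v t + (1 - θ (t + 1)) * M ^ 2) * D / 2) -
      ((M / 2 + M * √H / θ 0) *
        ((1 - θ (t + 1)) * g (t + 1) ^ 2 / v (t + 1) / √(1 - θ (t + 1))) +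
        M * √H / θ 0 * √(1 - θ (t + 1))) ≤
    D * (m (t + 1) / √(v (t + 1))) := by
  have h1 := S.gradient_term_ge P hε hM D t
  have h2 := S.momentum_term_ge P hε hM hH hD t
  have hb := P.beta_nonneg (t + 1)
  have hb1 : β (t + 1) ≤ 1 := (P.beta_le _).trans P.beta_lt.le
  have hw := P.sqrt_pos (t + 1)
  have he0 : 0 ≤ (1 - θ (t + 1)) * g (t + 1) ^ 2 / v (t + 1) / √(1 - θ (t + 1)) :=
    div_nonneg (S.e_nonneg P hε (t + 1)) hw.le
  have hθ0 := P.theta_pos 0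
  have hc : 0 ≤ M * √H / θ 0 := by positivity
  set E := (1 - θ (t + 1)) * g (t + 1) ^ 2 / v (t + 1) / √(1 - θ (t + 1))
  set w := √(1 - θ (t + 1))
  set p := √(θ (t + 1) * v t + (1 - θ (t + 1)) * M ^ 2)
  have h3 := mul_le_mul_of_nonneg_left h2 hb
  have h4 := mul_le_mul_of_nonneg_left h1 (sub_nonneg.2 hb1)
  have h5 : D * (m (t + 1) / √(v (t + 1))) = β (t + 1) * (D * m t / √(v (t + 1))) +
      (1 - β (t + 1)) * (D * g (t + 1) / √(v (t + 1))) := by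
    rw [S.m_succ]; ring
  have h6 : (1 - β (t + 1)) * (M / 2 * E) ≤ 1 * (M / 2 * E) :=
    mul_le_mul_of_nonneg_right (by linarith) (by positivity)
  have h7 : β (t + 1) * (M * √H / θ 0 * (w + E)) ≤ 1 * (M * √H / θ 0 * (w + E)) :=
    mul_le_mul_of_nonneg_right hb1 (by positivity)
  have h8 : D / p * g (t + 1) - D / p * D / 2 = D * g (t + 1) / p - D ^ 2 / p / 2 := by ring
  rw [h5, h8, ← mul_div_assoc]
  linarith

end ScalarAdam

end D2ACE

/-! ### Deterministic estimates along vector trajectories -/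

namespace D2ACE

variable {d : ℕ}

theorem inner_param (x y : Param d) : inner ℝ x y = ∑ k, x k * y k := by
  rw [PiLp.inner_apply]
  exact sum_congr rfl fun k _ => by simp [mul_comm]

theorem norm_sq_param (x : Param d) : ‖x‖ ^ 2 = ∑ k, x k ^ 2 := by
  rw [← real_inner_self_eq_norm_sq, inner_param]
  exact sum_congr rfl fun k _ => by ring

theorem abs_apply_le_norm (x : Param d) (k : Fin d) : |x k| ≤ ‖x‖ := PiLp.norm_apply_le x k

/-- A quadratic upper bound for functions with Lipschitz gradient. -/
theorem le_add_inner_add_sq {f : Param d → ℝ} (hf : Differentiable ℝ f) {L : NNReal}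
    (hL : LipschitzWith L (gradient f)) (x y : Param d) :
    f y ≤ f x + inner ℝ (gradient f x) (y - x) + L * ‖y - x‖ ^ 2 := by
  let φ : ℝ → ℝ := fun s => f (x + s • (y - x))
  have hφ : ∀ s, HasDerivAt φ (inner ℝ (gradient f (x + s • (y - x))) (y - x)) s := by
    intro s
    have h1 : HasDerivAt (fun s : ℝ => x + s • (y - x)) (y - x) s := by
      simpa using ((hasDerivAt_id s).smul_const (y - x)).const_add x
    have h2 := (hf (x + s • (y - x))).hasGradientAt.hasFDerivAt.comp_hasDerivAt s h1
    rw [show φ = f ∘ fun s : ℝ => x + s • (y - x) from rfl]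
    exact h2
  -- The mean value theorem avoids integration, at the cost of the constant L instead of L/2.
  obtain ⟨s, hs, hslope⟩ := exists_hasDerivAt_eq_slope φ _ zero_lt_one
    (fun s _ => (hφ s).continuousAt.continuousWithinAt) (fun s _ => hφ s)
  have h1 : f y - f x = inner ℝ (gradient f (x + s • (y - x))) (y - x) := by
    rw [hslope]; simp [φ]
  have h2 : inner ℝ (gradient f (x + s • (y - x)) - gradient f x) (y - x) ≤ L * ‖y - x‖ ^ 2 := by
    refine (real_inner_le_norm _ _).trans ?_
    have h3 := hL.norm_sub_le (x + s • (y - x)) x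
    rw [add_sub_cancel_left, norm_smul, Real.norm_of_nonneg hs.1.le] at h3
    have h4 : (L : ℝ) * (s * ‖y - x‖) ≤ L * (1 * ‖y - x‖) := by
      have := hs.2.le
      gcongr
    nlinarith [mul_le_mul_of_nonneg_right (h3.trans h4) (norm_nonneg (y - x))]
  rw [inner_sub_left] at h2
  linarith

/-- The update direction `m / √v`. -/
noncomputable def updateDir (m v : Param d) : Param d := WithLp.toLp 2 fun k => m k / √(v k)

/-- The gradient `D`, preconditioned by the predictable bound `θ v + (1 - θ) M ^ 2` of the next
second moment. -/
noncomputable def precond (θ M : ℝ) (D v : Param d) : Param d :=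
  WithLp.toLp 2 fun k => D k / √(θ * v k + (1 - θ) * M ^ 2)

/-- The normalized energy of the stochastic gradient. -/
noncomputable def gradEnergy (θ : ℝ) (g v : Param d) : ℝ := ∑ k, (1 - θ) * g k ^ 2 / v k

/-- A trajectory of generic Adam with bounded gradients. -/
structure AdamPath (f : Param d → ℝ) (α β θ : ℕ → ℝ) (ε M : ℝ) (x m v g : ℕ → Param d) :
    Prop where
  scalar : ∀ k, ScalarAdam β θ ε M (fun t => g t k) (fun t => m t k) (fun t => v t k)
  grad_le : ∀ t, ‖gradient f (x (t + 1))‖ ≤ M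
  x_succ : ∀ t, x (t + 1 + 1) = x (t + 1) - α (t + 1) • updateDir (m (t + 1)) (v (t + 1))

/-- The error of one step of the recursion for the inner product of gradient and update
direction. -/
noncomputable def stepError (α θ : ℕ → ℝ) (c : ℝ) (m v g : ℕ → Param d) (t : ℕ) : ℝ :=
  c * (gradEnergy (θ (t + 1)) (g (t + 1)) (v (t + 1)) / √(1 - θ (t + 1)) +
    α t * ‖updateDir (m t) (v t)‖ ^ 2 + √(1 - θ (t + 1)))

namespace AdamPath

variable {f : Param d → ℝ} {α β θ a : ℕ → ℝ} {β₀ C₀ ε M H : ℝ} {x m v g : ℕ → Param d}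

theorem updateDir_zero (A : AdamPath f α β θ ε M x m v g) : updateDir (m 0) (v 0) = 0 := by
  ext k
  simp [updateDir, (A.scalar k).m_zero]

theorem updateDir_norm_sq (A : AdamPath f α β θ ε M x m v g) (P : AdamParams α β θ a β₀ C₀)
    (hε : 0 < ε) (t : ℕ) : ‖updateDir (m t) (v t)‖ ^ 2 = ∑ k, m t k ^ 2 / v t k := by
  rw [norm_sq_param]
  refine sum_congr rfl fun k _ => ?_
  simp only [updateDir]
  rw [div_pow, Real.sq_sqrt ((A.scalar k).v_pos P hε t).le]

theorem theta_mul_updateDir (A : AdamPath f α β θ ε M x m v g) (P : AdamParams α β θ a β₀ C₀)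
    (hε : 0 < ε) (t : ℕ) : (1 - θ t) * ‖updateDir (m t) (v t)‖ ^ 2 =
      ∑ k, (1 - θ t) * m t k ^ 2 / v t k := by
  rw [A.updateDir_norm_sq P hε, mul_sum]
  exact sum_congr rfl fun k _ => by ring

theorem theta_mul_updateDir_le (A : AdamPath f α β θ ε M x m v g) (P : AdamParams α β θ a β₀ C₀)
    (hε : 0 < ε) (hH : ∀ k t, (1 - θ t) * m t k ^ 2 / v t k ≤ H) (t : ℕ) :
    (1 - θ t) * ‖updateDir (m t) (v t)‖ ^ 2 ≤ d * H := by
  rw [A.theta_mul_updateDir P hε]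
  calc ∑ k, (1 - θ t) * m t k ^ 2 / v t k ≤ ∑ _k : Fin d, H := sum_le_sum fun k _ => hH k t
    _ = d * H := by simp

theorem gradEnergy_nonneg (A : AdamPath f α β θ ε M x m v g) (P : AdamParams α β θ a β₀ C₀)
    (hε : 0 < ε) (t : ℕ) : 0 ≤ gradEnergy (θ t) (g t) (v t) :=
  sum_nonneg fun k _ => (A.scalar k).e_nonneg P hε t

theorem gradEnergy_le (A : AdamPath f α β θ ε M x m v g) (P : AdamParams α β θ a β₀ C₀)
    (hε : 0 < ε) (t : ℕ) : gradEnergy (θ (t + 1)) (g (t + 1)) (v (t + 1)) ≤ d := by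
  calc gradEnergy (θ (t + 1)) (g (t + 1)) (v (t + 1)) ≤ ∑ _k : Fin d, (1 : ℝ) :=
        sum_le_sum fun k _ => (A.scalar k).e_le_one P hε t
    _ = d := by simp

/-- Summing `direction_step` over the coordinates leaves ⟨D_{t+1}, U_t⟩. Passing to ⟨D_t, U_t⟩ costs
L α_t ‖U_t‖², by the Lipschitz bound along the last update. -/
theorem inner_step (A : AdamPath f α β θ ε M x m v g) (P : AdamParams α β θ a β₀ C₀)
    (hε : 0 < ε) (hM : 0 < M) (hH0 : 0 < H) (hH : ∀ k t, (1 - θ t) * m t k ^ 2 / v t k ≤ H)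
    {L : NNReal} (hL : LipschitzWith L (gradient f)) {c : ℝ}
    (hc : M / 2 + M * √H / θ 0 + d * (M * √H / θ 0) + L ≤ c) (t : ℕ) :
    β (t + 1) * inner ℝ (gradient f (x t)) (updateDir (m t) (v t)) + (1 - β (t + 1)) *
      (inner ℝ (precond (θ (t + 1)) M (gradient f (x (t + 1))) (v t)) (g (t + 1)) -
        inner ℝ (precond (θ (t + 1)) M (gradient f (x (t + 1))) (v t))
          (gradient f (x (t + 1))) / 2) - stepError α θ c m v g t ≤
    inner ℝ (gradient f (x (t + 1))) (updateDir (m (t + 1)) (v (t + 1))) := by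
  have hb := P.beta_nonneg (t + 1)
  have hb1 : β (t + 1) ≤ 1 := (P.beta_le _).trans P.beta_lt.le
  have hw := P.sqrt_pos (t + 1)
  have hθ0 := P.theta_pos 0
  have hα := P.alpha_pos t
  have hk := sum_le_sum fun k (_ : k ∈ (univ : Finset (Fin d))) =>
    (A.scalar k).direction_step P hε hM (hH k)
      ((abs_apply_le_norm (gradient f (x (t + 1))) k).trans (A.grad_le t)) t
  simp only [sum_sub_distrib, sum_add_distrib, ← mul_sum, ← sum_div, sum_const, card_univ,
    Fintype.card_fin, nsmul_eq_mul] at hk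
  have hlip : inner ℝ (gradient f (x t)) (updateDir (m t) (v t)) -
      inner ℝ (gradient f (x (t + 1))) (updateDir (m t) (v t)) ≤
      L * (α t * ‖updateDir (m t) (v t)‖ ^ 2) := by
    cases t with
    -- The point `x 0` is arbitrary, but U_0 = 0.
    | zero => simp [A.updateDir_zero]
    | succ t =>
      rw [← inner_sub_left]
      refine (real_inner_le_norm _ _).trans ?_
      have h1 := hL.norm_sub_le (x (t + 1)) (x (t + 1 + 1))
      rw [A.x_succ t, sub_sub_cancel, norm_smul, Real.norm_of_nonneg hα.le, ← A.x_succ t] at h1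
      nlinarith [mul_le_mul_of_nonneg_right h1 (norm_nonneg (updateDir (m (t + 1)) (v (t + 1))))]
  have hin : ∀ s r : ℕ, inner ℝ (gradient f (x r)) (updateDir (m s) (v s)) =
      ∑ k, gradient f (x r) k * (m s k / √(v s k)) := fun s r => inner_param _ _
  have hpre : ∀ y : Param d, inner ℝ (precond (θ (t + 1)) M (gradient f (x (t + 1))) (v t)) y =
      ∑ k, gradient f (x (t + 1)) k / √(θ (t + 1) * v t k + (1 - θ (t + 1)) * M ^ 2) * y k :=
    fun y => inner_param _ _
  rw [← hin, ← hin, ← hpre, ← hpre] at hk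
  have he : ∑ k, (1 - θ (t + 1)) * g (t + 1) k ^ 2 / v (t + 1) k =
      gradEnergy (θ (t + 1)) (g (t + 1)) (v (t + 1)) := rfl
  rw [he] at hk
  have he0 : 0 ≤ gradEnergy (θ (t + 1)) (g (t + 1)) (v (t + 1)) / √(1 - θ (t + 1)) :=
    div_nonneg (A.gradEnergy_nonneg P hε _) hw.le
  have hq0 : 0 ≤ α t * ‖updateDir (m t) (v t)‖ ^ 2 := by positivity
  unfold stepError
  set E := gradEnergy (θ (t + 1)) (g (t + 1)) (v (t + 1)) / √(1 - θ (t + 1))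
  set q := α t * ‖updateDir (m t) (v t)‖ ^ 2
  set w := √(1 - θ (t + 1))
  have hX : 0 ≤ M * √H / θ 0 := by positivity
  have hdX : 0 ≤ d * (M * √H / θ 0) := by positivity
  have hL0 : (0 : ℝ) ≤ L := L.coe_nonneg
  have h1 : (M / 2 + M * √H / θ 0) * E ≤ c * E := mul_le_mul_of_nonneg_right (by linarith) he0
  have h2 : (L : ℝ) * q ≤ c * q := mul_le_mul_of_nonneg_right (by linarith) hq0
  have h3 : d * (M * √H / θ 0) * w ≤ c * w := mul_le_mul_of_nonneg_right (by linarith) hw.le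
  have h4 := mul_le_mul_of_nonneg_left hlip hb
  have h5 : β (t + 1) * (L * q) ≤ 1 * (L * q) :=
    mul_le_mul_of_nonneg_right hb1 (mul_nonneg hL0 hq0)
  linarith

theorem sum_gradEnergy_le (A : AdamPath f α β θ ε M x m v g) (P : AdamParams α β θ a β₀ C₀)
    (hε : 0 < ε) (T : ℕ) :
    ∑ t ∈ range T, a (t + 1) * gradEnergy (θ (t + 1)) (g (t + 1)) (v (t + 1)) ≤
      d * (a 0 * (Real.log (ε + M ^ 2) - Real.log ε) +
        (∑ t ∈ range T, a (t + 1) * (1 - θ (t + 1))) / θ 0) := by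
  simp only [gradEnergy, mul_sum]
  rw [sum_comm]
  refine (sum_le_sum fun k _ => (A.scalar k).sum_e_le P hε T).trans ?_
  simp [mul_add]

theorem sum_updateDir_le (A : AdamPath f α β θ ε M x m v g) (P : AdamParams α β θ a β₀ C₀)
    (hε : 0 < ε) (hH : ∀ k t, (1 - θ t) * m t k ^ 2 / v t k ≤ H) (T : ℕ) :
    ∑ t ∈ range T, a (t + 1) * ((1 - θ (t + 1)) * ‖updateDir (m (t + 1)) (v (t + 1))‖ ^ 2) ≤
      (∑ t ∈ range T, a (t + 1) * gradEnergy (θ (t + 1)) (g (t + 1)) (v (t + 1)) +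
        d * (H / θ 0 * ∑ t ∈ range T, a (t + 1) * (1 - θ (t + 1)))) / (1 - β₀) := by
  simp only [A.theta_mul_updateDir P hε, gradEnergy, mul_sum (univ : Finset (Fin d))]
  rw [sum_comm]
  refine (sum_le_sum fun k _ => (A.scalar k).sum_h_le P hε (hH k) T).trans ?_
  rw [← sum_div, sum_add_distrib, sum_comm]
  simp

/-- The weight a_t w_t is non-increasing, so it can be taken at index t and combined with α_t ≤ C₀
a_t w_t; U_0 = 0 then allows the shift of the summation index. -/
theorem sum_step_mul_le (A : AdamPath f α β θ ε M x m v g) (P : AdamParams α β θ a β₀ C₀) (T : ℕ) :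
    ∑ t ∈ range T, a (t + 1) * √(1 - θ (t + 1)) * (α t * ‖updateDir (m t) (v t)‖ ^ 2) ≤
      C₀ * a 0 *
      ∑ t ∈ range T, a (t + 1) * ((1 - θ (t + 1)) * ‖updateDir (m (t + 1)) (v (t + 1))‖ ^ 2) := by
  have hterm : ∀ t, a (t + 1) * √(1 - θ (t + 1)) * (α t * ‖updateDir (m t) (v t)‖ ^ 2) ≤
      C₀ * a 0 * (a t * ((1 - θ t) * ‖updateDir (m t) (v t)‖ ^ 2)) := by
    intro t
    have h1 : a (t + 1) * √(1 - θ (t + 1)) ≤ a t * √(1 - θ t) := P.step_anti t.le_succ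
    have h2 := P.alpha_le t
    have h3 := P.anti (Nat.zero_le t)
    have hs := P.step_pos t
    have hα := P.alpha_pos t
    have hC := P.C_pos
    have ha := P.a_pos t
    have hθ : 0 ≤ 1 - θ t := by linarith [P.theta_lt t]
    calc a (t + 1) * √(1 - θ (t + 1)) * (α t * ‖updateDir (m t) (v t)‖ ^ 2)
        ≤ a t * √(1 - θ t) * (C₀ * (a t * √(1 - θ t)) * ‖updateDir (m t) (v t)‖ ^ 2) := by gcongr
      _ = C₀ * a t * (a t * (√(1 - θ t) ^ 2 * ‖updateDir (m t) (v t)‖ ^ 2)) := by ring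
      _ = C₀ * a t * (a t * ((1 - θ t) * ‖updateDir (m t) (v t)‖ ^ 2)) := by rw [P.sq_sqrt]
      _ ≤ C₀ * a 0 * (a t * ((1 - θ t) * ‖updateDir (m t) (v t)‖ ^ 2)) := by gcongr
  refine (sum_le_sum fun t _ => hterm t).trans ?_
  rw [← mul_sum]
  refine mul_le_mul_of_nonneg_left ?_ (mul_pos P.C_pos (P.a_pos 0)).le
  have hnn : ∀ t, 0 ≤ a t * ((1 - θ t) * ‖updateDir (m t) (v t)‖ ^ 2) := fun t =>
    mul_nonneg (P.a_pos t).le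
      (mul_nonneg (by linarith [P.theta_lt t]) (sq_nonneg _))
  calc ∑ t ∈ range T, a t * ((1 - θ t) * ‖updateDir (m t) (v t)‖ ^ 2)
      ≤ ∑ t ∈ range (T + 1), a t * ((1 - θ t) * ‖updateDir (m t) (v t)‖ ^ 2) :=
        sum_le_sum_of_subset_of_nonneg (range_mono T.le_succ) fun t _ _ => hnn t
    _ = _ := by rw [sum_range_succ']; simp [A.updateDir_zero]

/-- The function values telescope in the quadratic upper bound, and α² ≤ C₀² a² (1-θ) turns its
quadratic term into a weighted energy. -/
theorem sum_inner_le (A : AdamPath f α β θ ε M x m v g) (P : AdamParams α β θ a β₀ C₀)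
    (hf : Differentiable ℝ f) {L : NNReal} (hL : LipschitzWith L (gradient f)) {F : ℝ}
    (hF : ∀ y, F ≤ f y) (T : ℕ) :
    ∑ t ∈ range T, α (t + 1) *
        inner ℝ (gradient f (x (t + 1))) (updateDir (m (t + 1)) (v (t + 1))) ≤
      f (x 1) - F + L * (C₀ ^ 2 * a 0 *
      ∑ t ∈ range T, a (t + 1) * ((1 - θ (t + 1)) * ‖updateDir (m (t + 1)) (v (t + 1))‖ ^ 2)) := by
  have hstep : ∀ t, α (t + 1) *
      inner ℝ (gradient f (x (t + 1))) (updateDir (m (t + 1)) (v (t + 1))) ≤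
      f (x (t + 1)) - f (x (t + 1 + 1)) + L * (C₀ ^ 2 * a 0 *
        (a (t + 1) * ((1 - θ (t + 1)) * ‖updateDir (m (t + 1)) (v (t + 1))‖ ^ 2))) := by
    intro t
    have h1 := le_add_inner_add_sq hf hL (x (t + 1)) (x (t + 1 + 1))
    have hα := P.alpha_pos (t + 1)
    rw [A.x_succ t, sub_sub_cancel_left, inner_neg_right, inner_smul_right, norm_neg, norm_smul,
      Real.norm_of_nonneg hα.le, mul_pow, ← A.x_succ t] at h1
    have h2 : α (t + 1) ^ 2 * ‖updateDir (m (t + 1)) (v (t + 1))‖ ^ 2 ≤ C₀ ^ 2 * a 0 *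
        (a (t + 1) * ((1 - θ (t + 1)) * ‖updateDir (m (t + 1)) (v (t + 1))‖ ^ 2)) := by
      have h3 := P.anti (Nat.zero_le (t + 1))
      have ha := P.a_pos (t + 1)
      have hθ : 0 ≤ 1 - θ (t + 1) := by linarith [P.theta_lt (t + 1)]
      calc α (t + 1) ^ 2 * ‖updateDir (m (t + 1)) (v (t + 1))‖ ^ 2
          ≤ (C₀ * (a (t + 1) * √(1 - θ (t + 1)))) ^ 2 *
            ‖updateDir (m (t + 1)) (v (t + 1))‖ ^ 2 := by
            gcongr
            exact P.alpha_le _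
        _ = C₀ ^ 2 * a (t + 1) * (a (t + 1) * (√(1 - θ (t + 1)) ^ 2 *
            ‖updateDir (m (t + 1)) (v (t + 1))‖ ^ 2)) := by ring
        _ = C₀ ^ 2 * a (t + 1) * (a (t + 1) * ((1 - θ (t + 1)) *
            ‖updateDir (m (t + 1)) (v (t + 1))‖ ^ 2)) := by rw [P.sq_sqrt]
        _ ≤ _ := by gcongr
    have h4 := mul_le_mul_of_nonneg_left h2 L.coe_nonneg
    linarith
  refine (sum_le_sum fun t _ => hstep t).trans ?_
  rw [sum_add_distrib, sum_range_sub' (fun t => f (x (t + 1))), ← mul_sum, ← mul_sum]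
  linarith [hF (x (T + 1))]

end AdamPath

/-- Deterministic bounds along all trajectories with bounded gradients. -/
theorem exists_path_bounds {f : Param d → ℝ} {α β θ a : ℕ → ℝ} {β₀ C₀ ε M : ℝ}
    (P : AdamParams α β θ a β₀ C₀) (hε : 0 < ε) (hM : 0 < M) (hf : Differentiable ℝ f)
    {L : NNReal} (hL : LipschitzWith L (gradient f)) (hbd : BddBelow (Set.range f))
    (x₁ : Param d) :
    ∃ c C : ℝ, 0 ≤ c ∧ 0 ≤ C ∧ ∀ x m v g : ℕ → Param d, AdamPath f α β θ ε M x m v g → x 1 = x₁ →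
      (∀ t, β (t + 1) * inner ℝ (gradient f (x t)) (updateDir (m t) (v t)) + (1 - β (t + 1)) *
        (inner ℝ (precond (θ (t + 1)) M (gradient f (x (t + 1))) (v t)) (g (t + 1)) -
          inner ℝ (precond (θ (t + 1)) M (gradient f (x (t + 1))) (v t))
            (gradient f (x (t + 1))) / 2) - stepError α θ c m v g t ≤
        inner ℝ (gradient f (x (t + 1))) (updateDir (m (t + 1)) (v (t + 1)))) ∧
      (∀ T, ∑ t ∈ range T, a (t + 1) * √(1 - θ (t + 1)) * stepError α θ c m v g t ≤
        C * (1 + ∑ t ∈ range T, α (t + 1) * √(1 - θ (t + 1)))) ∧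
      (∀ T, ∑ t ∈ range T, α (t + 1) *
        inner ℝ (gradient f (x (t + 1))) (updateDir (m (t + 1)) (v (t + 1))) ≤
        C * (1 + ∑ t ∈ range T, α (t + 1) * √(1 - θ (t + 1)))) ∧
      ∀ t, (1 - θ t) * ‖updateDir (m t) (v t)‖ ^ 2 ≤ C := by
  obtain ⟨H, hH, hHb⟩ := ScalarAdam.exists_h_le (M := M) P hε
  obtain ⟨F, hF⟩ := hbd
  have hF' : ∀ y, F ≤ f y := fun y => hF ⟨y, rfl⟩
  have hθ0 := P.theta_pos 0
  have ha0 := P.a_pos 0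
  have hC0 := P.C_pos
  have hβ1 : 0 < 1 - β₀ := by linarith [P.beta_lt]
  have hlog : 0 ≤ Real.log (ε + M ^ 2) - Real.log ε :=
    sub_nonneg.2 (Real.log_le_log hε (by nlinarith [sq_nonneg M]))
  have hx₁ : 0 ≤ f x₁ - F := sub_nonneg.2 (hF' x₁)
  -- All constants are fixed before a trajectory is introduced; they depend on it only through its
  -- starting point.
  let c : ℝ := M / 2 + M * √H / θ 0 + d * (M * √H / θ 0) + L
  let K₁ : ℝ := d * (a 0 * (Real.log (ε + M ^ 2) - Real.log ε) + 1 / θ 0)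
  let K₂ : ℝ := (K₁ + d * (H / θ 0)) / (1 - β₀)
  have hc : 0 ≤ c := by positivity
  have hK₁ : 0 ≤ K₁ := by positivity
  have hK₂ : 0 ≤ K₂ := by positivity
  let C₁ : ℝ := c * (K₁ + C₀ * a 0 * K₂ + 1)
  let C₂ : ℝ := f x₁ - F + L * (C₀ ^ 2 * a 0 * K₂)
  have hC₁ : 0 ≤ C₁ := by positivity
  have hC₂ : 0 ≤ C₂ := by positivity
  refine ⟨c, C₁ + C₂ + d * H, hc, by positivity, fun x m v g A hx => ?_⟩
  have hHk : ∀ k t, (1 - θ t) * m t k ^ 2 / v t k ≤ H := fun k => hHb _ _ _ (A.scalar k)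
  have hS0 : ∀ T, 0 ≤ ∑ t ∈ range T, α (t + 1) * √(1 - θ (t + 1)) := fun T =>
    sum_nonneg fun t _ => mul_nonneg (P.alpha_pos _).le (Real.sqrt_nonneg _)
  have hS : ∀ T, ∑ t ∈ range T, a (t + 1) * (1 - θ (t + 1)) ≤
      ∑ t ∈ range T, α (t + 1) * √(1 - θ (t + 1)) := by
    refine fun T => sum_le_sum fun t _ => ?_
    have h1 := mul_le_mul_of_nonneg_right (P.le_alpha (t + 1)) (P.sqrt_pos (t + 1)).le
    have h2 := P.sq_sqrt (t + 1)
    rwa [mul_assoc, ← sq, h2] at h1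
  have hE : ∀ T, ∑ t ∈ range T, a (t + 1) * gradEnergy (θ (t + 1)) (g (t + 1)) (v (t + 1)) ≤
      K₁ * (1 + ∑ t ∈ range T, α (t + 1) * √(1 - θ (t + 1))) := by
    intro T
    refine (A.sum_gradEnergy_le P hε T).trans ?_
    simp only [K₁]
    rw [mul_assoc]
    refine mul_le_mul_of_nonneg_left ?_ (Nat.cast_nonneg d)
    have h1 := div_le_div_of_nonneg_right (hS T) hθ0.le
    have h2 := mul_nonneg (mul_nonneg ha0.le hlog) (hS0 T)
    have h3 : 0 ≤ 1 / θ 0 := by positivity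
    rw [add_mul, one_div_mul_eq_div, add_div]
    linarith
  have hQ : ∀ T, ∑ t ∈ range T, a (t + 1) *
      ((1 - θ (t + 1)) * ‖updateDir (m (t + 1)) (v (t + 1))‖ ^ 2) ≤
      K₂ * (1 + ∑ t ∈ range T, α (t + 1) * √(1 - θ (t + 1))) := by
    intro T
    refine (A.sum_updateDir_le P hε hHk T).trans ?_
    simp only [K₂]
    rw [div_mul_eq_mul_div (K₁ + d * (H / θ 0))]
    refine div_le_div_of_nonneg_right ?_ hβ1.le
    have h1 : d * (H / θ 0 * ∑ t ∈ range T, a (t + 1) * (1 - θ (t + 1))) ≤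
        d * (H / θ 0 * (1 + ∑ t ∈ range T, α (t + 1) * √(1 - θ (t + 1)))) := by
      have := hS T
      gcongr
      linarith
    linarith [hE T]
  refine ⟨A.inner_step P hε hM hH hHk hL le_rfl, fun T => ?_, fun T => ?_, fun t => ?_⟩
  · have hsplit : ∑ t ∈ range T, a (t + 1) * √(1 - θ (t + 1)) * stepError α θ c m v g t =
        c * (∑ t ∈ range T, a (t + 1) * gradEnergy (θ (t + 1)) (g (t + 1)) (v (t + 1)) +
          ∑ t ∈ range T, a (t + 1) * √(1 - θ (t + 1)) * (α t * ‖updateDir (m t) (v t)‖ ^ 2) +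
          ∑ t ∈ range T, a (t + 1) * (1 - θ (t + 1))) := by
      rw [← sum_add_distrib, ← sum_add_distrib, mul_sum]
      refine sum_congr rfl fun t _ => ?_
      have hw := P.sqrt_pos (t + 1)
      have hw2 := P.sq_sqrt (t + 1)
      rw [← hw2, Real.sqrt_sq hw.le]
      simp only [stepError]
      field_simp
    rw [hsplit]
    have h1 := A.sum_step_mul_le P T
    have h2 := mul_le_mul_of_nonneg_left (hQ T) (mul_pos hC0 ha0).le
    have h3 : c * (∑ t ∈ range T, a (t + 1) * gradEnergy (θ (t + 1)) (g (t + 1)) (v (t + 1)) +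
          ∑ t ∈ range T, a (t + 1) * √(1 - θ (t + 1)) * (α t * ‖updateDir (m t) (v t)‖ ^ 2) +
          ∑ t ∈ range T, a (t + 1) * (1 - θ (t + 1))) ≤
        C₁ * (1 + ∑ t ∈ range T, α (t + 1) * √(1 - θ (t + 1))) := by
      simp only [C₁]
      rw [mul_assoc]
      refine mul_le_mul_of_nonneg_left ?_ hc
      linarith [hE T, hS T]
    refine h3.trans (mul_le_mul_of_nonneg_right ?_ (by linarith [hS0 T]))
    have : 0 ≤ (d : ℝ) * H := by positivity
    linarith
  · refine (A.sum_inner_le P hf hL hF' T).trans ?_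
    rw [hx]
    have h2 := mul_le_mul_of_nonneg_left (mul_le_mul_of_nonneg_left (hQ T)
      (by positivity : 0 ≤ C₀ ^ 2 * a 0)) L.coe_nonneg
    have h3 : 0 ≤ (C₁ + d * H) * (1 + ∑ t ∈ range T, α (t + 1) * √(1 - θ (t + 1))) :=
      mul_nonneg (by positivity) (by linarith [hS0 T])
    have h4 : 0 ≤ (f x₁ - F) * ∑ t ∈ range T, α (t + 1) * √(1 - θ (t + 1)) :=
      mul_nonneg hx₁ (hS0 T)
    simp only [C₂]
    linarith
  · linarith [A.theta_mul_updateDir_le P hε hHk t]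

end D2ACE

/-! ### Passing to expectations and averaging over the iterations -/

namespace D2ACE

variable {d : ℕ}

/-- The sequence `X` may be negative, but never below minus the discounted sum `R` of the errors.
Hence κ N ≤ X + R, and both right-hand sums are controlled. Finally α_T ≤ C₀ α_t for t ≤ T removes
the weights on the left. -/
theorem weighted_average_bound {α β θ a : ℕ → ℝ} {β₀ C₀ κ C : ℝ} (P : AdamParams α β θ a β₀ C₀)
    (hκ : 0 < κ) {N X Y : ℕ → ℝ} (hN : ∀ t, 0 ≤ N t) (hY : ∀ t, 0 ≤ Y t) (hX0 : X 0 = 0)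
    (hstep : ∀ t, β (t + 1) * X t + κ * N (t + 1) - Y t ≤ X (t + 1)) {T : ℕ} {S : ℝ}
    (hYs : ∑ t ∈ range T, a (t + 1) * √(1 - θ (t + 1)) * Y t ≤ C * S)
    (hXs : ∑ t ∈ range T, α (t + 1) * X (t + 1) ≤ C * S) :
    α T * ∑ t ∈ range T, N (t + 1) ≤ C₀ * (C + C₀ * (C / (1 - β₀))) / κ * S := by
  have hβ1 : 0 < 1 - β₀ := by linarith [P.beta_lt]
  have hC0 := P.C_pos
  let R : ℕ → ℝ := fun t => Nat.rec 0 (fun t r => β₀ * r + Y t) t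
  have hRs : ∀ t, R (t + 1) = β₀ * R t + Y t := fun t => rfl
  have hR0 : ∀ t, 0 ≤ R t := by
    intro t
    induction t with
    | zero => exact le_rfl
    | succ t ih => rw [hRs]; have := mul_nonneg P.beta₀_nonneg ih; linarith [hY t]
  have hXR : ∀ t, -R t ≤ X t := by
    intro t
    induction t with
    | zero => rw [hX0]; exact neg_nonpos.2 (hR0 0)
    | succ t ih =>
      rw [hRs]
      have h1 := mul_le_mul_of_nonneg_left ih (P.beta_nonneg (t + 1))
      have h2 := mul_le_mul_of_nonneg_right (P.beta_le (t + 1)) (hR0 t)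
      linarith [hstep t, mul_nonneg hκ.le (hN (t + 1))]
  have hNX : ∀ t, κ * N (t + 1) ≤ X (t + 1) + R (t + 1) := by
    intro t
    rw [hRs]
    have h1 := mul_le_mul_of_nonneg_left (hXR t) (P.beta_nonneg (t + 1))
    have h2 := mul_le_mul_of_nonneg_right (P.beta_le (t + 1)) (hR0 t)
    linarith [hstep t]
  have hRsum : ∑ t ∈ range T, a (t + 1) * √(1 - θ (t + 1)) * R (t + 1) ≤ C * S / (1 - β₀) := by
    have h := weighted_sum_le_of_discounted (a := fun t => a t * √(1 - θ t)) (X := R)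
      (Y := fun t => Y (t - 1)) P.beta₀_nonneg P.beta_lt P.step_anti (fun t => (P.step_pos t).le)
      rfl hR0 (fun t => (hRs t).le) T
    simp only [Nat.add_sub_cancel] at h
    exact h.trans (div_le_div_of_nonneg_right hYs hβ1.le)
  have hαR : ∑ t ∈ range T, α (t + 1) * R (t + 1) ≤ C₀ * (C * S / (1 - β₀)) := by
    refine le_trans ?_ (mul_le_mul_of_nonneg_left hRsum hC0.le)
    rw [mul_sum]
    refine sum_le_sum fun t _ => ?_
    rw [← mul_assoc]
    exact mul_le_mul_of_nonneg_right (P.alpha_le (t + 1)) (hR0 (t + 1))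
  have hαN : κ * ∑ t ∈ range T, α (t + 1) * N (t + 1) ≤ C * S + C₀ * (C * S / (1 - β₀)) := by
    refine le_trans ?_ (add_le_add hXs hαR)
    rw [mul_sum, ← sum_add_distrib]
    refine sum_le_sum fun t _ => ?_
    have := mul_le_mul_of_nonneg_left (hNX t) (P.alpha_pos (t + 1)).le
    linarith
  have hαT : α T * ∑ t ∈ range T, N (t + 1) ≤ C₀ * ∑ t ∈ range T, α (t + 1) * N (t + 1) := by
    rw [mul_sum, mul_sum]
    refine sum_le_sum fun t ht => ?_
    rw [← mul_assoc]
    refine mul_le_mul_of_nonneg_right ?_ (hN _)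
    refine (P.alpha_le T).trans (mul_le_mul_of_nonneg_left ?_ hC0.le)
    exact (P.step_anti (Nat.succ_le_of_lt (mem_range.1 ht))).trans (P.le_alpha (t + 1))
  rw [div_mul_eq_mul_div, le_div_iff₀ hκ]
  calc (α T * ∑ t ∈ range T, N (t + 1)) * κ
      ≤ (C₀ * ∑ t ∈ range T, α (t + 1) * N (t + 1)) * κ := mul_le_mul_of_nonneg_right hαT hκ.le
    _ = C₀ * (κ * ∑ t ∈ range T, α (t + 1) * N (t + 1)) := by ring
    _ ≤ C₀ * (C * S + C₀ * (C * S / (1 - β₀))) := mul_le_mul_of_nonneg_left hαN hC0.le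
    _ = C₀ * (C + C₀ * (C / (1 - β₀))) * S := by ring

/-- The part (1-θ) M² alone bounds the denominator from below. The estimate serves integrability
only, so its growth as θ → 1 does no harm. -/
theorem norm_precond_le {θ M : ℝ} (hθ0 : 0 ≤ θ) (hθ : θ < 1) (hM : 0 < M) {D v : Param d}
    (hv : ∀ k, 0 ≤ v k) : ‖precond θ M D v‖ ≤ ‖D‖ / (√(1 - θ) * M) := by
  have hθ' : 0 < 1 - θ := by linarith
  have hw : 0 < √(1 - θ) := Real.sqrt_pos.2 hθ'
  refine le_of_sq_le_sq ?_ (by positivity)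
  rw [norm_sq_param, div_pow, norm_sq_param, mul_pow, Real.sq_sqrt hθ'.le, sum_div]
  refine sum_le_sum fun k _ => ?_
  have h1 : 0 ≤ θ * v k := mul_nonneg hθ0 (hv k)
  have h2 : 0 < (1 - θ) * M ^ 2 := by positivity
  simp only [precond]
  rw [div_pow, Real.sq_sqrt (by linarith)]
  exact div_le_div_of_nonneg_left (sq_nonneg _) h2 (by linarith)

/-- The quantity under each root is a convex combination of v_k and M², hence at most `V`. -/
theorem inner_precond_ge {θ M V : ℝ} (hθ0 : 0 ≤ θ) (hθ : θ < 1) (hM : 0 < M) {D v : Param d}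
    (hv : ∀ k, 0 ≤ v k) (hvV : ∀ k, v k ≤ V) (hMV : M ^ 2 ≤ V) :
    ‖D‖ ^ 2 / √V ≤ inner ℝ (precond θ M D v) D := by
  rw [norm_sq_param, inner_param, sum_div]
  refine sum_le_sum fun k _ => ?_
  have h1 : 0 ≤ θ * v k := mul_nonneg hθ0 (hv k)
  have h2 : 0 < (1 - θ) * M ^ 2 := mul_pos (by linarith) (by positivity)
  have h3 : θ * v k + (1 - θ) * M ^ 2 ≤ V := by
    nlinarith [mul_le_mul_of_nonneg_left (hvV k) hθ0,
      mul_le_mul_of_nonneg_left hMV (sub_nonneg.2 hθ.le)]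
  simp only [precond]
  rw [div_mul_eq_mul_div, ← sq]
  exact div_le_div_of_nonneg_left (sq_nonneg _) (Real.sqrt_pos.2 (by linarith))
    (Real.sqrt_le_sqrt h3)

section Measurability

variable {Ω : Type*} {_ : MeasurableSpace Ω}

theorem measurable_updateDir {m v : Ω → Param d} (hm : Measurable m) (hv : Measurable v) :
    Measurable fun ω => updateDir (m ω) (v ω) :=
  measurable_param fun k => (measurable_param_apply hm k).div (measurable_param_apply hv k).sqrt

theorem measurable_precond (θ M : ℝ) {D v : Ω → Param d} (hD : Measurable D)
    (hv : Measurable v) : Measurable fun ω => precond θ M (D ω) (v ω) :=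
  measurable_param fun k => (measurable_param_apply hD k).div
    (((measurable_param_apply hv k).const_mul _).add_const _).sqrt

theorem measurable_gradEnergy (θ : ℝ) {g v : Ω → Param d} (hg : Measurable g)
    (hv : Measurable v) : Measurable fun ω => gradEnergy θ (g ω) (v ω) :=
  Finset.measurable_fun_sum _ fun k _ =>
    (((measurable_param_apply hg k).pow_const 2).const_mul _).div (measurable_param_apply hv k)

end Measurability

theorem integrable_of_measurable_bound {E Ω : Type*} [NormedAddCommGroup E] [MeasurableSpace E]
    [OpensMeasurableSpace E] [SecondCountableTopology E]
    {_ : MeasurableSpace Ω} {μ : Measure Ω} [IsFiniteMeasure μ] {f : Ω → E}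
    (hf : Measurable f) {C : ℝ} (h : ∀ᵐ ω ∂μ, ‖f ω‖ ≤ C) : Integrable f μ :=
  Integrable.of_bound hf.aestronglyMeasurable C h

/-- Conditionally centred perturbations do not change the mean of an inner product with a
predictable vector. -/
theorem integral_inner_eq_of_condExp {Ω : Type*} {m mΩ : MeasurableSpace Ω} (hm : m ≤ mΩ)
    {μ : Measure Ω} [IsProbabilityMeasure μ] {ξ g D : Ω → Param d} (hξ : Measurable[m] ξ)
    (hg : Integrable g μ) (hξg : Integrable (fun ω => inner ℝ (ξ ω) (g ω)) μ)
    (hD : μ[g | m] =ᵐ[μ] D) :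
    ∫ ω, inner ℝ (ξ ω) (g ω) ∂μ = ∫ ω, inner ℝ (ξ ω) (D ω) ∂μ := by
  have h := condExp_bilin_of_aestronglyMeasurable_left (m := m) (innerSL ℝ)
    hξ.stronglyMeasurable.aestronglyMeasurable hξg hg
  rw [← integral_condExp hm]
  refine integral_congr_ae (h.trans ?_)
  filter_upwards [hD] with ω hω
  rw [hω]
  rfl

theorem sum_Icc_one_eq_sum_range (F : ℕ → ℝ) (T : ℕ) :
    ∑ t ∈ Icc 1 T, F t = ∑ t ∈ range T, F (t + 1) := by
  induction T with
  | zero => simp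
  | succ T ih => rw [Finset.sum_Icc_succ_top (by omega), ih, sum_range_succ]

namespace Run

variable {n q : ℕ} {loss : Fin n → Fin q → Param d → ℝ} {b : ℕ} {Δ W sMax : ℝ}
  {α β θ : ℕ → ℝ} {ε M : ℝ} {x₁ : Param d} {Ω : Type*} [mΩ : MeasurableSpace Ω] {μ : Measure Ω}
  (R : Run loss b Δ W sMax α β θ ε x₁ μ)

theorem ae_adamPath
    (h : ∀ᵐ ω ∂μ, ∀ t, 1 ≤ t → ‖R.g t ω‖ ≤ M ∧ ‖gradient (empiricalLoss loss) (R.x t ω)‖ ≤ M) :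
    ∀ᵐ ω ∂μ, AdamPath (empiricalLoss loss) α β θ ε M (fun t => R.x t ω) (fun t => R.m t ω)
      (fun t => R.v t ω) (fun t => R.g t ω) := by
  filter_upwards [h] with ω hω
  refine ⟨fun k => ⟨R.m_init ω k, R.v_init ω k, fun t => R.m_step (t + 1) (Nat.le_add_left 1 t) ω k,
    fun t => R.v_step (t + 1) (Nat.le_add_left 1 t) ω k,
    fun t => (abs_apply_le_norm _ k).trans (hω (t + 1) (Nat.le_add_left 1 t)).1⟩,
    fun t => (hω (t + 1) (Nat.le_add_left 1 t)).2, fun t => ?_⟩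
  ext k
  rw [R.x_step (t + 1) (Nat.le_add_left 1 t)]
  simp [updateDir, mul_div_assoc]

theorem measurable_x_mΩ (t : ℕ) : Measurable (R.x (t + 1)) :=
  (R.measurable_iterates t).1.mono (R.ℱ.le _) le_rfl

theorem measurable_m_mΩ (t : ℕ) : Measurable (R.m t) :=
  (R.measurable_iterates t).2.1.mono (R.ℱ.le _) le_rfl

theorem measurable_v_mΩ (t : ℕ) : Measurable (R.v t) :=
  (R.measurable_iterates t).2.2.mono (R.ℱ.le _) le_rfl

theorem measurable_g_mΩ (t : ℕ) : Measurable (R.g (t + 1)) :=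
  (R.measurable_g (Nat.le_add_left 1 t)).mono (R.ℱ.le _) le_rfl

/-- Replacing parameters outside of the indices that a run uses. -/
def congrParams {α' β' θ' : ℕ → ℝ} (hα : ∀ t, 1 ≤ t → α' t = α t) (hβ : ∀ t, 1 ≤ t → β' t = β t)
    (hθ : ∀ t, 1 ≤ t → θ' t = θ t) : Run loss b Δ W sMax α' β' θ' ε x₁ μ :=
  { R with
    v_step := fun t ht ω k => by rw [hθ t ht]; exact R.v_step t ht ω k
    m_step := fun t ht ω k => by rw [hβ t ht]; exact R.m_step t ht ω k
    x_step := fun t ht ω k => by rw [hα t ht]; exact R.x_step t ht ω k }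

/-- The error bound for a run, in terms of the deterministic bounds for its trajectories. -/
theorem weighted_sum_sqGrad_le [IsProbabilityMeasure μ] {a : ℕ → ℝ} {β₀ C₀ c C : ℝ}
    (P : AdamParams α β θ a β₀ C₀) (hε : 0 < ε) (hM : 0 < M) (hc : 0 ≤ c)
    (hunb : ∀ t, 1 ≤ t → μ[R.g t | R.ℱ t] =ᵐ[μ] fun ω => gradient (empiricalLoss loss) (R.x t ω))
    (hbd : ∀ᵐ ω ∂μ, ∀ t, 1 ≤ t → ‖R.g t ω‖ ≤ M ∧ ‖gradient (empiricalLoss loss) (R.x t ω)‖ ≤ M)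
    (hpath : ∀ x m v g : ℕ → Param d,
      AdamPath (empiricalLoss loss) α β θ ε M x m v g → x 1 = x₁ →
      (∀ t, β (t + 1) * inner ℝ (gradient (empiricalLoss loss) (x t)) (updateDir (m t) (v t)) +
        (1 - β (t + 1)) *
        (inner ℝ (precond (θ (t + 1)) M (gradient (empiricalLoss loss) (x (t + 1))) (v t))
            (g (t + 1)) -
          inner ℝ (precond (θ (t + 1)) M (gradient (empiricalLoss loss) (x (t + 1))) (v t))
            (gradient (empiricalLoss loss) (x (t + 1))) / 2) - stepError α θ c m v g t ≤
        inner ℝ (gradient (empiricalLoss loss) (x (t + 1)))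
          (updateDir (m (t + 1)) (v (t + 1)))) ∧
      (∀ T, ∑ t ∈ range T, a (t + 1) * √(1 - θ (t + 1)) * stepError α θ c m v g t ≤
        C * (1 + ∑ t ∈ range T, α (t + 1) * √(1 - θ (t + 1)))) ∧
      (∀ T, ∑ t ∈ range T, α (t + 1) * inner ℝ (gradient (empiricalLoss loss) (x (t + 1)))
          (updateDir (m (t + 1)) (v (t + 1))) ≤
        C * (1 + ∑ t ∈ range T, α (t + 1) * √(1 - θ (t + 1)))) ∧
      ∀ t, (1 - θ t) * ‖updateDir (m t) (v t)‖ ^ 2 ≤ C) (T : ℕ) :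
    α T * ∑ t ∈ range T, ∫ ω, ‖gradient (empiricalLoss loss) (R.x (t + 1) ω)‖ ^ 2 ∂μ ≤
      C₀ * (C + C₀ * (C / (1 - β₀))) / ((1 - β₀) / (2 * √(ε + M ^ 2))) *
        (1 + ∑ t ∈ range T, α (t + 1) * √(1 - θ (t + 1))) := by
  set f := empiricalLoss loss with hf
  have hA := R.ae_adamPath hbd
  have hall : ∀ᵐ ω ∂μ, _ := hA.mono fun ω h => hpath _ _ _ _ h (R.x_init ω)
  have hβ1 : 0 < 1 - β₀ := by linarith [P.beta_lt]
  have hV : 0 < √(ε + M ^ 2) := Real.sqrt_pos.2 (by positivity)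
  have mD : ∀ t, Measurable fun ω => gradient f (R.x (t + 1) ω) := fun t =>
    (measurable_gradient f).comp (R.measurable_x_mΩ t)
  have mU : ∀ t, Measurable fun ω => updateDir (R.m t ω) (R.v t ω) := fun t =>
    measurable_updateDir (R.measurable_m_mΩ t) (R.measurable_v_mΩ t)
  have hDb : ∀ t, ∀ᵐ ω ∂μ, ‖gradient f (R.x (t + 1) ω)‖ ≤ M := fun t =>
    hA.mono fun ω h => h.grad_le t
  have hgb : ∀ t, ∀ᵐ ω ∂μ, ‖R.g (t + 1) ω‖ ≤ M := fun t =>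
    hbd.mono fun ω h => (h (t + 1) (Nat.le_add_left 1 t)).1
  have hUb : ∀ t, ∀ᵐ ω ∂μ, ‖updateDir (R.m t ω) (R.v t ω)‖ ^ 2 ≤ C / (1 - θ t) := fun t =>
    hall.mono fun ω h => by
      rw [le_div_iff₀ (by linarith [P.theta_lt t]), mul_comm]
      exact h.2.2.2 t
  have hpb : ∀ t, ∀ᵐ ω ∂μ, ‖precond (θ (t + 1)) M (gradient f (R.x (t + 1) ω)) (R.v t ω)‖ ≤
      M / (√(1 - θ (t + 1)) * M) := fun t => hA.mono fun ω h => by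
    refine (norm_precond_le (P.theta_pos _).le (P.theta_lt _) hM
      fun k => ((h.scalar k).v_pos P hε t).le).trans ?_
    have := P.sqrt_pos (t + 1)
    have := h.grad_le t
    gcongr
  -- Measurability with respect to the past, not merely on Ω, is what allows g_{t+1} to be replaced
  -- by its conditional mean in `hZW`.
  have mp : ∀ t, Measurable[R.ℱ (t + 1)] fun ω =>
      precond (θ (t + 1)) M (gradient f (R.x (t + 1) ω)) (R.v t ω) := fun t =>
    measurable_precond _ _ ((measurable_gradient f).comp (R.measurable_iterates t).1)
      (R.measurable_iterates t).2.2
  have mp' := fun t => (mp t).mono (R.ℱ.le (t + 1)) le_rfl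
  have iX : ∀ t, Integrable
      (fun ω => inner ℝ (gradient f (R.x t ω)) (updateDir (R.m t ω) (R.v t ω))) μ := by
    intro t
    cases t with
    | zero =>
      refine (integrable_zero Ω ℝ μ).congr ?_
      filter_upwards [hA] with ω h
      rw [h.updateDir_zero]
      simp
    | succ t =>
      refine integrable_of_measurable_bound (C := M * √(C / (1 - θ (t + 1))))
        ((mD t).inner (mU (t + 1))) ?_
      filter_upwards [hDb t, hUb (t + 1)] with ω h1 h2
      exact (norm_inner_le_norm _ _).trans
        (mul_le_mul h1 (Real.le_sqrt_of_sq_le h2) (norm_nonneg _) hM.le)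
  have iY : ∀ t, Integrable (fun ω => stepError α θ c (fun t => R.m t ω) (fun t => R.v t ω)
      (fun t => R.g t ω) t) μ := by
    intro t
    have i1 : Integrable (fun ω => gradEnergy (θ (t + 1)) (R.g (t + 1) ω) (R.v (t + 1) ω)) μ := by
      refine integrable_of_measurable_bound (C := d)
        (measurable_gradEnergy _ (R.measurable_g_mΩ t) (R.measurable_v_mΩ (t + 1))) ?_
      filter_upwards [hA] with ω h
      rw [Real.norm_of_nonneg (h.gradEnergy_nonneg P hε (t + 1))]
      exact h.gradEnergy_le P hε t
    have i2 : Integrable (fun ω => ‖updateDir (R.m t ω) (R.v t ω)‖ ^ 2) μ := by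
      refine integrable_of_measurable_bound (C := C / (1 - θ t)) ((mU t).norm.pow_const 2) ?_
      filter_upwards [hUb t] with ω h
      rwa [Real.norm_of_nonneg (sq_nonneg _)]
    exact (((i1.div_const _).add (i2.const_mul _)).add (integrable_const _)).const_mul c
  have ig : ∀ t, Integrable (R.g (t + 1)) μ := fun t =>
    integrable_of_measurable_bound (R.measurable_g_mΩ t) (hgb t)
  have iN : ∀ t, Integrable (fun ω => ‖gradient f (R.x (t + 1) ω)‖ ^ 2) μ := by
    intro t
    refine integrable_of_measurable_bound (C := M ^ 2) ((mD t).norm.pow_const 2) ?_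
    filter_upwards [hDb t] with ω h
    rw [Real.norm_of_nonneg (sq_nonneg _)]
    gcongr
  have iZ : ∀ t, Integrable (fun ω => inner ℝ
      (precond (θ (t + 1)) M (gradient f (R.x (t + 1) ω)) (R.v t ω)) (R.g (t + 1) ω)) μ := by
    intro t
    refine integrable_of_measurable_bound ((mp' t).inner (R.measurable_g_mΩ t))
      (C := M / (√(1 - θ (t + 1)) * M) * M) ?_
    filter_upwards [hpb t, hgb t] with ω h1 h2
    exact (norm_inner_le_norm _ _).trans
      (mul_le_mul h1 h2 (norm_nonneg _) ((norm_nonneg _).trans h1))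
  have iW : ∀ t, Integrable (fun ω => inner ℝ
      (precond (θ (t + 1)) M (gradient f (R.x (t + 1) ω)) (R.v t ω))
        (gradient f (R.x (t + 1) ω))) μ := by
    intro t
    refine integrable_of_measurable_bound ((mp' t).inner (mD t))
      (C := M / (√(1 - θ (t + 1)) * M) * M) ?_
    filter_upwards [hpb t, hDb t] with ω h1 h2
    exact (norm_inner_le_norm _ _).trans
      (mul_le_mul h1 h2 (norm_nonneg _) ((norm_nonneg _).trans h1))
  have hZW := fun t => integral_inner_eq_of_condExp (R.ℱ.le (t + 1)) (mp t) (ig t) (iZ t)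
    (hunb (t + 1) (Nat.le_add_left 1 t))
  have hWN : ∀ t, (∫ ω, ‖gradient f (R.x (t + 1) ω)‖ ^ 2 ∂μ) / √(ε + M ^ 2) ≤
      ∫ ω, inner ℝ (precond (θ (t + 1)) M (gradient f (R.x (t + 1) ω)) (R.v t ω))
        (gradient f (R.x (t + 1) ω)) ∂μ := by
    intro t
    rw [← integral_div]
    refine integral_mono_ae ((iN t).div_const _) (iW t) ?_
    filter_upwards [hA] with ω h
    exact inner_precond_ge (P.theta_pos _).le (P.theta_lt _) hM
      (fun k => ((h.scalar k).v_pos P hε t).le) (fun k => (h.scalar k).v_le P hε t) (by linarith)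
  refine weighted_average_bound P
    (N := fun t => ∫ ω, ‖gradient f (R.x t ω)‖ ^ 2 ∂μ)
    (X := fun t => ∫ ω, inner ℝ (gradient f (R.x t ω)) (updateDir (R.m t ω) (R.v t ω)) ∂μ)
    (Y := fun t => ∫ ω, stepError α θ c (fun t => R.m t ω) (fun t => R.v t ω)
      (fun t => R.g t ω) t ∂μ)
    (by positivity) (fun t => integral_nonneg fun ω => sq_nonneg _) (fun t => ?_) ?_
    (fun t => ?_) ?_ ?_
  · refine integral_nonneg_of_ae ?_
    filter_upwards [hA] with ω h
    refine mul_nonneg hc (add_nonneg (add_nonneg ?_ ?_) (Real.sqrt_nonneg _))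
    · exact div_nonneg (h.gradEnergy_nonneg P hε (t + 1)) (Real.sqrt_nonneg _)
    · exact mul_nonneg (P.alpha_pos t).le (sq_nonneg _)
  · refine integral_eq_zero_of_ae ?_
    filter_upwards [hA] with ω h
    rw [h.updateDir_zero]
    simp
  · have h1 := integral_mono_ae (((iX t).const_mul (β (t + 1))).add
      (((iZ t).sub ((iW t).div_const 2)).const_mul (1 - β (t + 1))) |>.sub (iY t)) (iX (t + 1))
      (hall.mono fun ω h => h.1 t)
    rw [integral_sub' (((iX t).const_mul (β (t + 1))).add
      (((iZ t).sub ((iW t).div_const 2)).const_mul (1 - β (t + 1)))) (iY t),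
      integral_add' ((iX t).const_mul (β (t + 1)))
      (((iZ t).sub ((iW t).div_const 2)).const_mul (1 - β (t + 1))), integral_const_mul,
      integral_const_mul, integral_sub' (iZ t) ((iW t).div_const 2), integral_div, hZW t] at h1
    refine le_trans ?_ h1
    have h2 := hWN t
    have h3 : 0 ≤ ∫ ω, ‖gradient f (R.x (t + 1) ω)‖ ^ 2 ∂μ :=
      integral_nonneg fun ω => sq_nonneg _
    set N := ∫ ω, ‖gradient f (R.x (t + 1) ω)‖ ^ 2 ∂μ
    set I := ∫ ω, inner ℝ (precond (θ (t + 1)) M (gradient f (R.x (t + 1) ω)) (R.v t ω))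
        (gradient f (R.x (t + 1) ω)) ∂μ
    -- This is the source of κ: half of the main term survives Young's inequality, and 1 - β is at
    -- least 1 - β₀.
    have h4 : (1 - β₀) / (2 * √(ε + M ^ 2)) * N ≤ (1 - β (t + 1)) * (I - I / 2) := by
      calc (1 - β₀) / (2 * √(ε + M ^ 2)) * N = (1 - β₀) * (N / √(ε + M ^ 2) / 2) := by
            field_simp
        _ ≤ (1 - β (t + 1)) * (I - I / 2) := by
            refine mul_le_mul ?_ (by linarith) (by positivity) ?_
            · linarith [P.beta_le (t + 1)]
            · linarith [P.beta_le (t + 1)]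
    linarith
  · simp only [← integral_const_mul]
    rw [← integral_finsetSum _ fun t _ => (iY t).const_mul _]
    refine (integral_mono_ae (integrable_finsetSum _ fun t _ => (iY t).const_mul _)
      (integrable_const _) (hall.mono fun ω h => h.2.1 T)).trans ?_
    simp
  · simp only [← integral_const_mul]
    rw [← integral_finsetSum _ fun t _ => (iX (t + 1)).const_mul _]
    refine (integral_mono_ae (integrable_finsetSum _ fun t _ => (iX (t + 1)).const_mul _)
      (integrable_const _) (hall.mono fun ω h => h.2.2.1 T)).trans ?_
    simp

end Run

end D2ACE

/-! ### The convergence bound under the conditions on the parameters -/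

namespace D2ACE

/-- Nothing is assumed at index 0; composing with `max 1` copies the value at 1 there and changes
nothing later. -/
theorem AlmostNonincreasing.exists_adamParams {α β θ : ℕ → ℝ} {β₀ : ℝ}
    (hα : ∀ t, 1 ≤ t → 0 < α t) (hβ1 : β₀ < 1) (hβ : ∀ t, 1 ≤ t → 0 ≤ β t ∧ β t ≤ β₀)
    (hθ : ∀ t, 1 ≤ t → 0 < θ t ∧ θ t < 1) (hmono : MonotoneOn θ (Set.Ici 1))
    (hlim : Tendsto θ atTop (𝓝 1))
    (hχ : AlmostNonincreasing fun t => α t / √(1 - θ t)) :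
    ∃ a : ℕ → ℝ, ∃ C₀ : ℝ, AdamParams (fun t => α (max 1 t)) (fun t => β (max 1 t))
      (fun t => θ (max 1 t)) a β₀ C₀ := by
  obtain ⟨a, C₀, hC₀, ha, hχ⟩ := hχ
  have h1 : ∀ t, 1 ≤ max 1 t := fun t => le_max_left 1 t
  have hw : ∀ t, 0 < √(1 - θ (max 1 t)) := fun t =>
    Real.sqrt_pos.2 (by linarith [(hθ _ (h1 t)).2])
  refine ⟨fun t => a (max 1 t), C₀, fun t => hα _ (h1 t), fun t => (hβ _ (h1 t)).1,
    fun t => (hβ _ (h1 t)).2, hβ1, fun t => (hθ _ (h1 t)).1, fun t => (hθ _ (h1 t)).2,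
    fun s t hst => hmono (h1 s) (h1 t) (max_le_max le_rfl hst), ?_,
    fun s t hst => ha (h1 s) (h1 t) (max_le_max le_rfl hst), hC₀, fun t => ?_, fun t => ?_⟩
  · refine hlim.congr' ?_
    filter_upwards [eventually_ge_atTop 1] with t ht
    rw [max_eq_right ht]
  · exact (le_div_iff₀ (hw t)).1 (hχ _ (h1 t)).1
  · rw [← mul_assoc]
    exact (div_le_iff₀ (hw t)).1 (hχ _ (h1 t)).2

/-- The convergence bound of generic Adam, uniform over all runs. -/
theorem exists_meanSqGrad_bound {d n q b : ℕ} (hn : 0 < n) (hb : 0 < b)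
    (loss : Fin n → Fin q → Param d → ℝ)
    (hdiff : ∀ i, Differentiable ℝ (instanceLoss loss i))
    (hbelow : BddBelow (Set.range (empiricalLoss loss)))
    (L : NNReal) (hL : LipschitzWith L (gradient (empiricalLoss loss)))
    (G Δ W sMax ε : ℝ) (hΔ : 0 < Δ) (hε : 0 < ε) (x₁ : Param d) {α β θ : ℕ → ℝ}
    (hα : ∀ t, 1 ≤ t → 0 < α t) (hβ : MomentumBounded β)
    (hθ : ∀ t, 1 ≤ t → 0 < θ t ∧ θ t < 1) (hmono : MonotoneOn θ (Set.Ici 1))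
    (hlim : Tendsto θ atTop (𝓝 1))
    (hχ : AlmostNonincreasing fun t => α t / √(1 - θ t)) :
    ∃ K : ℝ, 0 < K ∧ ∀ (Ω : Type*) [MeasurableSpace Ω] (μ : Measure Ω) [IsProbabilityMeasure μ]
      (R : Run loss b Δ W sMax α β θ ε x₁ μ), R.GradBounded G → ∀ T, 1 ≤ T →
      R.meanSqGrad T ≤ K * ((1 + ∑ t ∈ Icc 1 T, α t * √(1 - θ t)) / (T * α T)) := by
  obtain ⟨β₀, hβ1, hβ⟩ := hβ
  obtain ⟨a, C₀, P⟩ := hχ.exists_adamParams hα hβ1 hβ hθ hmono hlim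
  obtain ⟨M, hM, hunif⟩ := exists_uniform_bounds hn hb loss hdiff G Δ W sMax ε hΔ x₁
  obtain ⟨c, C, hc, hC, hpath⟩ := exists_path_bounds P hε hM
    (differentiable_empiricalLoss hdiff) hL hbelow x₁
  have hβ1' : 0 < 1 - β₀ := by linarith
  have hC₀ := P.C_pos
  set K := C₀ * (C + C₀ * (C / (1 - β₀))) / ((1 - β₀) / (2 * √(ε + M ^ 2)))
  have hK : 0 ≤ K := by positivity
  refine ⟨K + 1, by positivity, fun Ω _ μ _ R hG T hT => ?_⟩
  obtain ⟨-, hunb, hbd⟩ := hunif α β θ Ω μ R hG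
  have hmax : ∀ t, 1 ≤ t → max 1 t = t := fun t ht => max_eq_right ht
  -- The modified run has the same filtration, iterates and gradients, so the facts proved for `R`
  -- apply to it unchanged.
  have key := (R.congrParams (α' := fun t => α (max 1 t)) (β' := fun t => β (max 1 t))
    (θ' := fun t => θ (max 1 t)) (fun t ht => by rw [hmax t ht]) (fun t ht => by rw [hmax t ht])
    (fun t ht => by rw [hmax t ht])).weighted_sum_sqGrad_le P hε hM hc hunb hbd hpath T
  simp only [hmax T hT, hmax _ (Nat.le_add_left 1 _)] at key
  rw [← sum_Icc_one_eq_sum_range fun t => α t * √(1 - θ t)] at key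
  have hS : 0 ≤ ∑ t ∈ Icc 1 T, α t * √(1 - θ t) := sum_nonneg fun t ht =>
    mul_nonneg (hα t (mem_Icc.1 ht).1).le (Real.sqrt_nonneg _)
  have hTα : 0 < T * α T := mul_pos (by exact_mod_cast hT) (hα T hT)
  have hT0 : (0 : ℝ) < T := by exact_mod_cast hT
  rw [← mul_div_assoc, le_div_iff₀ hTα, Run.meanSqGrad, sum_Icc_one_eq_sum_range]
  calc 1 / (T : ℝ) * (∑ t ∈ range T,
        ∫ ω, ‖gradient (empiricalLoss loss) (R.x (t + 1) ω)‖ ^ 2 ∂μ) * (T * α T)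
      = α T * ∑ t ∈ range T, ∫ ω, ‖gradient (empiricalLoss loss) (R.x (t + 1) ω)‖ ^ 2 ∂μ := by
        field_simp
    _ ≤ K * (1 + ∑ t ∈ Icc 1 T, α t * √(1 - θ t)) := key
    _ ≤ (K + 1) * (1 + ∑ t ∈ Icc 1 T, α t * √(1 - θ t)) := by gcongr; linarith

/-- The sufficient condition forces the second-moment decays to tend to one. -/
theorem SufficientCondition.tendsto_theta {α β θ : ℕ → ℝ} (h : SufficientCondition α β θ) :
    Tendsto θ atTop (𝓝 1) := by
  obtain ⟨a, C₀, hC₀, ha, hχ⟩ := h.effective_stepsize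
  have hw : ∀ t, 1 ≤ t → 0 < √(1 - θ t) := fun t ht =>
    Real.sqrt_pos.2 (by linarith [(h.theta_mem t ht).2])
  have hle : ∀ T : ℕ, 1 ≤ T → √(1 - θ T) ≤
      C₀ * ((∑ t ∈ Icc 1 T, α t * √(1 - θ t)) / (T * α T)) := by
    intro T hT
    have hT0 : (0 : ℝ) < T := by exact_mod_cast hT
    have hTα : 0 < T * α T := mul_pos hT0 (h.stepsize_pos T hT)
    -- Every summand dominates the last value of a w², so the sum is at least T a_T w_T²; with α_T ≤
    -- C₀ a_T w_T the ratio in (iv) bounds w_T.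
    have hterm : ∀ t ∈ Icc 1 T, a T * √(1 - θ T) ^ 2 ≤ α t * √(1 - θ t) := by
      intro t ht
      have ht1 := (mem_Icc.1 ht).1
      have htT := (mem_Icc.1 ht).2
      have h1 : a t * √(1 - θ t) ≤ α t := (le_div_iff₀ (hw t ht1)).1 (hχ t ht1).1
      have h2 : a T ≤ a t := ha ht1 hT htT
      have h3 : √(1 - θ T) ≤ √(1 - θ t) :=
        Real.sqrt_le_sqrt (by linarith [h.theta_mono ht1 hT htT])
      have h4 : 0 < a t := by
        have := (div_pos (h.stepsize_pos t ht1) (hw t ht1)).trans_le (hχ t ht1).2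
        exact pos_of_mul_pos_right this hC₀.le
      calc a T * √(1 - θ T) ^ 2 ≤ a t * √(1 - θ t) ^ 2 := by gcongr
        _ = a t * √(1 - θ t) * √(1 - θ t) := by ring
        _ ≤ _ := mul_le_mul_of_nonneg_right h1 (hw t ht1).le
    have hsum := card_nsmul_le_sum _ _ _ hterm
    rw [Nat.card_Icc, Nat.add_sub_cancel, nsmul_eq_mul] at hsum
    have h5 : α T ≤ C₀ * a T * √(1 - θ T) := (div_le_iff₀ (hw T hT)).1 (hχ T hT).2
    rw [← mul_div_assoc, le_div_iff₀ hTα]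
    calc √(1 - θ T) * (T * α T) ≤ √(1 - θ T) * (T * (C₀ * a T * √(1 - θ T))) := by gcongr
      _ = C₀ * (T * (a T * √(1 - θ T) ^ 2)) := by ring
      _ ≤ _ := by gcongr
  have h0 : Tendsto (fun T => √(1 - θ T)) atTop (𝓝 0) := by
    refine squeeze_zero' (Eventually.of_forall fun T => Real.sqrt_nonneg _)
      (eventually_atTop.2 ⟨1, hle⟩) ?_
    simpa using h.stepsize_ratio.const_mul C₀
  have h1 : Tendsto (fun T => 1 - √(1 - θ T) ^ 2) atTop (𝓝 1) := by
    simpa using (h0.pow 2).const_sub 1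
  refine h1.congr' ?_
  filter_upwards [eventually_ge_atTop 1] with T hT
  rw [Real.sq_sqrt (by linarith [(h.theta_mem T hT).2])]
  ring

/-! ### Rates for polynomial parameters -/

section Rates

/-- Bernoulli's inequality for the exponent 1-σ ≤ 1, applied to 1 - 1/(T+1), bounds each term by an
increment of T^(1-σ)/(1-σ). -/
theorem sum_rpow_neg_le {σ : ℝ} (hσ0 : 0 ≤ σ) (hσ : σ < 1) (T : ℕ) :
    ∑ t ∈ Icc 1 T, (t : ℝ) ^ (-σ) ≤ (T : ℝ) ^ (1 - σ) / (1 - σ) := by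
  have hp : 0 < 1 - σ := by linarith
  induction T with
  | zero => simp [Real.zero_rpow hp.ne']
  | succ T ih =>
    rw [sum_Icc_succ_top (by omega)]
    have hT : (0 : ℝ) < ((T + 1 : ℕ) : ℝ) := by positivity
    have hT1 : (1 : ℝ) ≤ ((T + 1 : ℕ) : ℝ) := by exact_mod_cast Nat.le_add_left 1 T
    have h1 := rpow_one_add_le_one_add_mul_self
      (s := -(1 / ((T + 1 : ℕ) : ℝ))) (p := 1 - σ)
      (by rw [neg_le_neg_iff, div_le_one hT]; exact hT1) hp.le (by linarith)
    have h2 : (T : ℝ) = ((T + 1 : ℕ) : ℝ) * (1 + -(1 / ((T + 1 : ℕ) : ℝ))) := by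
      field_simp; push_cast; ring
    have h3 : (T : ℝ) ^ (1 - σ) = ((T + 1 : ℕ) : ℝ) ^ (1 - σ) *
        (1 + -(1 / ((T + 1 : ℕ) : ℝ))) ^ (1 - σ) := by
      rw [← Real.mul_rpow hT.le, ← h2]
      have : 1 / ((T + 1 : ℕ) : ℝ) ≤ 1 := by rw [div_le_one hT]; exact hT1
      linarith
    have h4 : ((T + 1 : ℕ) : ℝ) ^ (-σ) = ((T + 1 : ℕ) : ℝ) ^ (1 - σ) / ((T + 1 : ℕ) : ℝ) := by
      rw [← Real.rpow_sub_one hT.ne']; congr 1; ring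
    rw [le_div_iff₀ hp] at ih ⊢
    have h5 := mul_le_mul_of_nonneg_left h1 (Real.rpow_nonneg hT.le (1 - σ))
    rw [← h3] at h5
    rw [add_mul, h4]
    have h6 : ((T + 1 : ℕ) : ℝ) ^ (1 - σ) * (1 + (1 - σ) * -(1 / ((T + 1 : ℕ) : ℝ))) =
      ((T + 1 : ℕ) : ℝ) ^ (1 - σ) -
        ((T + 1 : ℕ) : ℝ) ^ (1 - σ) / ((T + 1 : ℕ) : ℝ) * (1 - σ) := by ring
    linarith

theorem sum_rpow_neg_one_le (T : ℕ) :
    ∑ t ∈ Icc 1 T, (t : ℝ) ^ (-1 : ℝ) ≤ 1 + Real.log T := by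
  have h := harmonic_le_one_add_log T
  rw [harmonic_eq_sum_Icc] at h
  push_cast at h
  simpa [Real.rpow_neg_one] using h

/-- Partial sums of `t ^ (-(s + r / 2))`, compared with the rate. -/
theorem exists_sum_rpow_le_adamRate {r s c : ℝ} (hr : 0 < r) (hrs : r ≤ 2 * s) (hc : 0 ≤ c) :
    ∃ C : ℝ, 0 < C ∧ ∀ T : ℕ, 2 ≤ T →
      1 + c * ∑ t ∈ Icc 1 T, (t : ℝ) ^ (-(s + r / 2)) ≤ C * adamRate r s T * (T : ℝ) ^ (1 - s) := by
  rcases lt_trichotomy (r / 2 + s) 1 with h | h | h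
  · have hp : 0 < 1 - (s + r / 2) := by linarith
    refine ⟨1 + c / (1 - (s + r / 2)), by positivity, fun T hT => ?_⟩
    have hT1 : (1 : ℝ) ≤ T := by exact_mod_cast (by omega : 1 ≤ T)
    have h1 := sum_rpow_neg_le (by linarith : 0 ≤ s + r / 2) (by linarith) T
    have h2 : (1 : ℝ) ≤ (T : ℝ) ^ (1 - (s + r / 2)) := Real.one_le_rpow hT1 hp.le
    rw [adamRate, if_pos h, mul_assoc, ← Real.rpow_add (by linarith)]
    rw [show -(r / 2) + (1 - s) = 1 - (s + r / 2) by ring, add_mul, one_mul]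
    have h3 := mul_le_mul_of_nonneg_left h1 hc
    have h4 : c / (1 - (s + r / 2)) * (T : ℝ) ^ (1 - (s + r / 2)) =
        c * ((T : ℝ) ^ (1 - (s + r / 2)) / (1 - (s + r / 2))) := by ring
    linarith
  · have hl2 : 0 < Real.log 2 := Real.log_pos one_lt_two
    -- T ≥ 2 gives log T ≥ log 2 > 0, which absorbs the constant 1 + c.
    refine ⟨(1 + c) / Real.log 2 + c, by positivity, fun T hT => ?_⟩
    have hT0 : (0 : ℝ) < T := by exact_mod_cast (by omega : 0 < T)
    have h1 := sum_rpow_neg_one_le T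
    have hlog : Real.log 2 ≤ Real.log T := Real.log_le_log two_pos (by exact_mod_cast hT)
    rw [adamRate, if_neg (by linarith), if_pos h, show s + r / 2 = 1 by linarith, mul_assoc,
      div_mul_cancel₀ _ (Real.rpow_pos_of_pos hT0 _).ne']
    have h3 := mul_le_mul_of_nonneg_left h1 hc
    have h4 : 1 + c ≤ (1 + c) / Real.log 2 * Real.log T := by
      rw [div_mul_eq_mul_div, le_div_iff₀ hl2]
      gcongr
    linarith
  · have hsum : Summable fun t : ℕ => (t : ℝ) ^ (-(s + r / 2)) :=
      Real.summable_nat_rpow.2 (by linarith)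
    have hZ : 0 ≤ ∑' t : ℕ, (t : ℝ) ^ (-(s + r / 2)) :=
      tsum_nonneg fun t => Real.rpow_nonneg (Nat.cast_nonneg t) _
    refine ⟨1 + c * ∑' t : ℕ, (t : ℝ) ^ (-(s + r / 2)), by positivity, fun T hT => ?_⟩
    have hT0 : (0 : ℝ) < T := by exact_mod_cast (by omega : 0 < T)
    rw [adamRate, if_neg (by linarith), if_neg (by linarith), mul_assoc, ← Real.rpow_add hT0]
    rw [neg_add_cancel, Real.rpow_zero, mul_one]
    have := hsum.sum_le_tsum (Icc 1 T) fun t _ => Real.rpow_nonneg (Nat.cast_nonneg t) _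
    gcongr

variable {η s r a : ℝ} {K : ℕ}

theorem one_sub_polyTheta (t : ℕ) : 1 - polyTheta a r K t = a / ((max K t : ℕ) : ℝ) ^ r := by
  unfold polyTheta
  split_ifs with h
  · rw [max_eq_left h.le]; ring
  · rw [max_eq_right (not_lt.1 h)]; ring

theorem sqrt_one_sub_polyTheta (ha : 0 < a) (t : ℕ) :
    √(1 - polyTheta a r K t) = √a / ((max K t : ℕ) : ℝ) ^ (r / 2) := by
  rw [one_sub_polyTheta, Real.sqrt_div ha.le, Real.sqrt_eq_rpow (_ ^ r),
    ← Real.rpow_mul (Nat.cast_nonneg _)]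
  ring_nf

theorem polyTheta_mem (hr : 0 < r) (ha : 0 < a) (hK : 1 ≤ K) (haK : a < (K : ℝ) ^ r) (t : ℕ) :
    0 < polyTheta a r K t ∧ polyTheta a r K t < 1 := by
  have hK0 : (0 : ℝ) < K := by exact_mod_cast hK
  have hM0 : (0 : ℝ) < ((max K t : ℕ) : ℝ) := by exact_mod_cast lt_max_of_lt_left hK
  have hM : (K : ℝ) ^ r ≤ ((max K t : ℕ) : ℝ) ^ r :=
    Real.rpow_le_rpow hK0.le (by exact_mod_cast le_max_left K t) hr.le
  have h := one_sub_polyTheta (a := a) (r := r) (K := K) t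
  have h1 : 0 < a / ((max K t : ℕ) : ℝ) ^ r := by positivity
  have h2 : a / ((max K t : ℕ) : ℝ) ^ r < 1 := by
    rw [div_lt_one (by positivity)]; linarith
  constructor <;> linarith

theorem monotone_polyTheta (hr : 0 < r) (ha : 0 < a) (hK : 1 ≤ K) :
    Monotone (polyTheta a r K) := by
  intro t t' htt
  have hM0 : (0 : ℝ) < ((max K t : ℕ) : ℝ) := by exact_mod_cast lt_max_of_lt_left hK
  have h : a / ((max K t' : ℕ) : ℝ) ^ r ≤ a / ((max K t : ℕ) : ℝ) ^ r := by
    have : ((max K t : ℕ) : ℝ) ≤ ((max K t' : ℕ) : ℝ) := by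
      exact_mod_cast max_le_max le_rfl htt
    gcongr
  rw [← one_sub_polyTheta, ← one_sub_polyTheta] at h
  linarith

theorem tendsto_polyTheta (hr : 0 < r) : Tendsto (polyTheta a r K) atTop (𝓝 1) := by
  have h1 : Tendsto (fun t : ℕ => 1 - a / (t : ℝ) ^ r) atTop (𝓝 1) := by
    have h := ((tendsto_rpow_atTop hr).comp tendsto_natCast_atTop_atTop).const_div_atTop a
    simpa using h.const_sub 1
  refine h1.congr' ?_
  filter_upwards [eventually_ge_atTop K] with t ht
  rw [polyTheta, if_neg (not_lt.2 ht)]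

theorem almostNonincreasing_poly (hη : 0 < η) (ha : 0 < a) (hrs : r ≤ 2 * s)
    (hs : 0 < s) (hK : 1 ≤ K) :
    AlmostNonincreasing fun t => polyStep η s t / √(1 - polyTheta a r K t) := by
  -- The effective stepsize is itself non-increasing: `hrepr` writes it as a product of two
  -- non-increasing factors, using r/2 ≤ s for the first.
  refine ⟨_, 1, one_pos, ?_, fun t _ => ⟨le_rfl, (one_mul _).ge⟩⟩
  have hrepr : ∀ t : ℕ, 1 ≤ t → polyStep η s t / √(1 - polyTheta a r K t) = η / √a *
      (((max K t : ℕ) : ℝ) ^ (r / 2 - s) * (((max K t : ℕ) : ℝ) / t) ^ s) := by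
    intro t ht
    have ht0 : (0 : ℝ) < t := by exact_mod_cast ht
    have hM0 : (0 : ℝ) < ((max K t : ℕ) : ℝ) := by exact_mod_cast lt_max_of_lt_left hK
    have ha' : 0 < √a := Real.sqrt_pos.2 ha
    rw [sqrt_one_sub_polyTheta ha, polyStep, Real.div_rpow hM0.le ht0.le, Real.rpow_sub hM0]
    have h1 := Real.rpow_pos_of_pos hM0 s
    have h2 := Real.rpow_pos_of_pos hM0 (r / 2)
    have h3 := Real.rpow_pos_of_pos ht0 s
    field_simp
  intro t ht t' ht' htt
  simp only [Set.mem_Ici] at ht ht'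
  simp only [hrepr t ht, hrepr t' ht']
  have ht0 : (0 : ℝ) < t := by exact_mod_cast ht
  have ht0' : (0 : ℝ) < t' := by exact_mod_cast ht'
  have htt' : (t : ℝ) ≤ t' := by exact_mod_cast htt
  have hM0 : (0 : ℝ) < ((max K t : ℕ) : ℝ) := by exact_mod_cast lt_max_of_lt_left hK
  have h1 : (((max K t' : ℕ) : ℝ)) ^ (r / 2 - s) ≤ (((max K t : ℕ) : ℝ)) ^ (r / 2 - s) :=
    Real.rpow_le_rpow_of_nonpos hM0 (by exact_mod_cast max_le_max le_rfl htt) (by linarith)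
  have h2 : ((max K t' : ℕ) : ℝ) / t' ≤ ((max K t : ℕ) : ℝ) / t := by
    push_cast
    rw [← max_div_div_right ht0.le, ← max_div_div_right ht0'.le, div_self ht0.ne',
      div_self ht0'.ne']
    gcongr
  gcongr

/-- Freezing θ before `K` only decreases √(1-θ_t) relative to √a / t^(r/2), because max(K, t) ≥ t.
-/
theorem sum_poly_le (hη : 0 < η) (hr : 0 < r) (ha : 0 < a) (T : ℕ) :
    ∑ t ∈ Icc 1 T, polyStep η s t * √(1 - polyTheta a r K t) ≤
      η * √a * ∑ t ∈ Icc 1 T, (t : ℝ) ^ (-(s + r / 2)) := by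
  rw [mul_sum]
  refine sum_le_sum fun t ht => ?_
  have ht0 : (0 : ℝ) < t := by exact_mod_cast (mem_Icc.1 ht).1
  have h1 : (t : ℝ) ^ (r / 2) ≤ ((max K t : ℕ) : ℝ) ^ (r / 2) :=
    Real.rpow_le_rpow ht0.le (by exact_mod_cast le_max_right K t) (by linarith)
  rw [sqrt_one_sub_polyTheta ha, polyStep, Real.rpow_neg ht0.le, Real.rpow_add ht0]
  calc η / (t : ℝ) ^ s * (√a / ((max K t : ℕ) : ℝ) ^ (r / 2))
      ≤ η / (t : ℝ) ^ s * (√a / (t : ℝ) ^ (r / 2)) := by gcongr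
    _ = _ := by field_simp

end Rates

end D2ACE

/-! ### Assembly of the three claims -/

theorem mainTheorem1 {d n q b : ℕ} (hn : 0 < n) (hb : 0 < b)
    (loss : Fin n → Fin q → D2ACE.Param d → ℝ)
    (hdiff : ∀ i, Differentiable ℝ (D2ACE.instanceLoss loss i))
    (hA1 : BddBelow (Set.range (D2ACE.empiricalLoss loss)))
    (L : NNReal) (hA2 : LipschitzWith L (gradient (D2ACE.empiricalLoss loss)))
    (G Δ W sMax ε : ℝ) (hΔ : 0 < Δ) (hε : 0 < ε) (x₁ : D2ACE.Param d) :
    -- the estimator satisfies (A1)–(A4)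
    (∃ Gt : ℝ, 0 < Gt ∧
      ∀ (α β θ : ℕ → ℝ) (Ω : Type*) [MeasurableSpace Ω] (μ : Measure Ω) [IsProbabilityMeasure μ]
        (R : D2ACE.Run loss b Δ W sMax α β θ ε x₁ μ), R.GradBounded G →
        (∀ t, 1 ≤ t → ∀ ω i, 0 < R.prob t ω i) ∧
        D2ACE.AdamAssumptions μ R.ℱ (D2ACE.empiricalLoss loss) L Gt R.x R.g ∧
        ∀ t, 1 ≤ t →
          Integrable (fun ω => ‖gradient (D2ACE.empiricalLoss loss) (R.x t ω)‖ ^ 2) μ) ∧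
    -- convergence under the sufficient condition
    (∀ α β θ : ℕ → ℝ, D2ACE.SufficientCondition α β θ →
      ∃ u : ℕ → ℝ, Tendsto u atTop (𝓝 0) ∧
        ∀ (Ω : Type*) [MeasurableSpace Ω] (μ : Measure Ω) [IsProbabilityMeasure μ]
          (R : D2ACE.Run loss b Δ W sMax α β θ ε x₁ μ), R.GradBounded G →
          ∀ T, 1 ≤ T → R.meanSqGrad T ≤ u T) ∧
    -- non-asymptotic rates
    (∀ (η s r a : ℝ) (K : ℕ) (β : ℕ → ℝ), 0 < η → 0 < r → r ≤ 2 * s → 2 * s < 2 →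
      0 < a → 1 ≤ K → a < (K : ℝ) ^ r → D2ACE.MomentumBounded β →
      ∃ C : ℝ, 0 < C ∧
        ∀ (Ω : Type*) [MeasurableSpace Ω] (μ : Measure Ω) [IsProbabilityMeasure μ]
          (R : D2ACE.Run loss b Δ W sMax (D2ACE.polyStep η s) β (D2ACE.polyTheta a r K)
            ε x₁ μ), R.GradBounded G →
          ∀ T, 2 ≤ T → R.meanSqGrad T ≤ C * D2ACE.adamRate r s T) := by
  refine ⟨?_, fun α β θ h => ?_, fun η s r a K β hη hr hrs hs2 ha hK haK hβ => ?_⟩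
  · obtain ⟨M, hM, hunif⟩ := D2ACE.exists_uniform_bounds hn hb loss hdiff G Δ W sMax ε hΔ x₁
    refine ⟨M ^ 2, by positivity, fun α β θ Ω _ μ _ R hG => ?_⟩
    obtain ⟨hpos, hunb, hbd⟩ := hunif α β θ Ω μ R hG
    have mg : ∀ t, 1 ≤ t → Measurable (R.g t) := fun t ht =>
      (R.measurable_g ht).mono (R.ℱ.le _) le_rfl
    have mD : ∀ t, 1 ≤ t → Measurable fun ω => gradient (D2ACE.empiricalLoss loss) (R.x t ω) :=
      fun t ht => (D2ACE.measurable_gradient _).comp ((R.measurable_x ht).mono (R.ℱ.le _) le_rfl)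
    have hg2 : ∀ t, 1 ≤ t → ∀ᵐ ω ∂μ, ‖R.g t ω‖ ^ 2 ≤ M ^ 2 := fun t ht => hbd.mono fun ω h =>
      pow_le_pow_left₀ (norm_nonneg _) (h t ht).1 2
    have hi : ∀ t, 1 ≤ t → Integrable (fun ω => ‖R.g t ω‖ ^ 2) μ := fun t ht =>
      D2ACE.integrable_of_measurable_bound ((mg t ht).norm.pow_const 2) (C := M ^ 2)
        ((hg2 t ht).mono fun ω h => by rwa [Real.norm_of_nonneg (sq_nonneg _)])
    refine ⟨hpos, ⟨hA1, D2ACE.differentiable_empiricalLoss hdiff, hA2, fun t ht => ?_, hunb, hi,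
      fun t ht => ?_⟩, fun t ht => ?_⟩
    · exact D2ACE.integrable_of_measurable_bound (mg t ht) (hbd.mono fun ω h => (h t ht).1)
    · refine (integral_mono_ae (hi t ht) (integrable_const _) (hg2 t ht)).trans ?_
      simp
    · refine D2ACE.integrable_of_measurable_bound ((mD t ht).norm.pow_const 2) (C := M ^ 2)
        (hbd.mono fun ω h => ?_)
      rw [Real.norm_of_nonneg (sq_nonneg _)]
      exact pow_le_pow_left₀ (norm_nonneg _) (h t ht).2 2
  · obtain ⟨K, hK, hbound⟩ := D2ACE.exists_meanSqGrad_bound hn hb loss hdiff hA1 L hA2 G Δ W sMax ε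
      hΔ hε x₁ h.stepsize_pos h.momentum h.theta_mem h.theta_mono h.tendsto_theta
      h.effective_stepsize
    have hα1 := h.stepsize_pos 1 le_rfl
    have hw1 : 0 < √(1 - θ 1) := Real.sqrt_pos.2 (by linarith [(h.theta_mem 1 le_rfl).2])
    -- The sum is at least its first term α_1 w_1 > 0, so the additive 1 in the bound is absorbed
    -- into a multiple of the sum.
    refine ⟨fun T => K * (1 / (α 1 * √(1 - θ 1)) + 1) *
      ((∑ t ∈ Icc 1 T, α t * √(1 - θ t)) / (T * α T)), ?_, fun Ω _ μ _ R hG T hT => ?_⟩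
    · simpa using h.stepsize_ratio.const_mul (K * (1 / (α 1 * √(1 - θ 1)) + 1))
    · refine (hbound Ω μ R hG T hT).trans ?_
      have hαT := h.stepsize_pos T hT
      have hT0 : (0 : ℝ) < T := by exact_mod_cast hT
      have h1 : α 1 * √(1 - θ 1) ≤ ∑ t ∈ Icc 1 T, α t * √(1 - θ t) :=
        single_le_sum (f := fun t => α t * √(1 - θ t))
          (fun t ht => mul_nonneg (h.stepsize_pos t (mem_Icc.1 ht).1).le (Real.sqrt_nonneg _))
          (mem_Icc.2 ⟨le_rfl, hT⟩)
      have h2 : 1 ≤ 1 / (α 1 * √(1 - θ 1)) * ∑ t ∈ Icc 1 T, α t * √(1 - θ t) := by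
        rw [one_div_mul_eq_div, one_le_div (by positivity)]
        exact h1
      beta_reduce
      rw [mul_assoc, ← mul_div_assoc (1 / (α 1 * √(1 - θ 1)) + 1), add_mul, one_mul]
      gcongr
  · have hs : 0 < s := by linarith
    have hstep : ∀ t : ℕ, 1 ≤ t → 0 < D2ACE.polyStep η s t := fun t ht =>
      div_pos hη (Real.rpow_pos_of_pos (by exact_mod_cast ht) s)
    obtain ⟨K', hK', hbound⟩ := D2ACE.exists_meanSqGrad_bound hn hb loss hdiff hA1 L hA2 G Δ W sMax
      ε hΔ hε x₁ hstep hβ (fun t _ => D2ACE.polyTheta_mem hr ha hK haK t)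
      ((D2ACE.monotone_polyTheta hr ha hK).monotoneOn _) (D2ACE.tendsto_polyTheta hr)
      (D2ACE.almostNonincreasing_poly hη ha hrs hs hK)
    obtain ⟨C, hC, hrate⟩ := D2ACE.exists_sum_rpow_le_adamRate hr hrs
      (by positivity : 0 ≤ η * √a)
    refine ⟨K' * (C / η), by positivity, fun Ω _ μ _ R hG T hT => ?_⟩
    refine (hbound Ω μ R hG T (by omega)).trans ?_
    have hT0 : (0 : ℝ) < T := by exact_mod_cast (by omega : 0 < T)
    have hTs := Real.rpow_pos_of_pos hT0 (1 - s)
    have h1 : (T : ℝ) * D2ACE.polyStep η s T = η * (T : ℝ) ^ (1 - s) := by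
      rw [D2ACE.polyStep, Real.rpow_sub hT0, Real.rpow_one]
      ring
    have h2 := D2ACE.sum_poly_le (s := s) (K := K) hη hr ha T
    rw [mul_assoc]
    refine mul_le_mul_of_nonneg_left ?_ hK'.le
    rw [h1, div_le_iff₀ (by positivity)]
    calc 1 + ∑ t ∈ Icc 1 T, D2ACE.polyStep η s t * √(1 - D2ACE.polyTheta a r K t)
        ≤ C * D2ACE.adamRate r s T * (T : ℝ) ^ (1 - s) := by linarith [hrate T hT]
      _ = C / η * D2ACE.adamRate r s T * (η * (T : ℝ) ^ (1 - s)) := by field_simp
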